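/- Let $p$ be a prime, $n\ge 1$, and let $K$ be a (nonarchimedean) local field of characteristic $p$ with normalized valuation $v_K$. Let $L/K$ be a totally ramified Galois extension with $\mathrm{Gal}(L/K)\cong C_{p^n}$; we also write $v_K$ for the extension of $v_K$ to $L$. Let $b_1<\dots<b_n$ and $u_1<\dots<u_n$ be the lower and upper ramification breaks of $L/K$. Let $W_n$ denote Witt vectors of length $n$, with addition $\oplus$ and multiplicative identity $\vec 1$, and let $\phi$ act on Witt vectors by raising each coordinate to the $p$-th power. Let $\vec\beta=(\beta_0,\dots,\beta_{n-1})\in W_n(K)$ be a reduced Witt vector (for each $i$, either $v_K(\beta_i)\ge 0$ or $p\nmid v_K(\beta_i)$) which corresponds to $L/K$: $\vec x=(x_0,\dots,x_{n-1})$ is a solution of $\phi(\vec x)=\vec x\oplus\vec\beta$ and $L=K(x_0,\dots,x_{n-1})$. Assume that there are $\omega_i,\delta_i\in K$ such that for $1\le i\le n-1$ $$\beta_i=\beta_0\,\omega_i^{p^{n-1}}+\delta_i,\qquad v_K(\delta_i)>v_K(\beta_i),\qquad b_{i+1}>p^n u_i,\qquad b_{i+1}>-p^{n-1}v_K(\delta_i).$$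 Let $\sigma$ be a generator of $\mathrm{Gal}(L/K)$ such that $\sigma(\vec x)=\vec x\oplus\vec 1$, where $\sigma$ acts on coordinates. Then: (a) for $0\le i\le n-1$, $(\sigma^{p^i}-1)(x_i)=1$; (b) for $0\le i<j\le n-1$, $v_K\big((\sigma^{p^i}-1)(x_j)\big)=-(1-p^{-1})(u_{i+1}+u_{i+2}+\cdots+u_j)$. -/

import Mathlib

noncomputable section

namespace LocalRamification

/-- The normalized additive valuation `v_F : F → ℤ ∪ {∞}` of a nonarchimedean local field `F`
(`v_F(F^×) = ℤ` and `v_F(0) = ∞`). -/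
def ord (F : Type*) [Field F] [ValuativeRel F] [TopologicalSpace F]
    [IsNonarchimedeanLocalField F] (x : F) : WithTop ℤ :=
  open Classical in
  if x = 0 then ⊤
  else ((-WithZero.log (IsNonarchimedeanLocalField.valueGroupWithZeroIsoInt F
    (ValuativeRel.valuation F x)) : ℤ) : WithTop ℤ)

section Extension

variable (K L : Type*) [Field K] [Field L] [Algebra K L]
  [ValuativeRel L] [TopologicalSpace L] [IsNonarchimedeanLocalField L]

/-- The ramification index of `L/K`: the least positive value of `v_L` on `K`. -/
def ramIndex : ℕ :=
  sInf {e : ℕ | 0 < e ∧ ∃ a : K, ord L (algebraMap K L a) = ((e : ℤ) : WithTop ℤ)}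

/-- `L/K` is totally ramified. -/
def IsTotallyRamified : Prop := ramIndex K L = Module.finrank K L

/-- The valuation `v_K` of the base field, extended to `L`: `v_K = v_L / e(L/K)`. -/
def ordBase (y : L) : WithTop ℚ :=
  (ord L y).map fun m : ℤ => (m : ℚ) / (ramIndex K L : ℚ)

/-- The ramification group `G_m` in the lower numbering (as a set of automorphisms):
those `σ` with `v_L(σ a - a) ≥ m + 1` for all `a ∈ 𝒪_L`. -/
def lowerGroup (m : ℕ) : Set (L ≃ₐ[K] L) :=
  {σ | ∀ a : L, 0 ≤ ord L a → (((m : ℤ) + 1 : ℤ) : WithTop ℤ) ≤ ord L (σ a - a)}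

/-- For a totally ramified extension `L/K` of degree `p ^ n`, the `i`-th lower ramification break
`b_i`, `1 ≤ i ≤ n`, counted with multiplicity: the largest `m` with `|G_m| > p ^ (n - i)`. -/
def lowerBreak (p n i : ℕ) : ℕ :=
  sSup {m : ℕ | p ^ (n - i) < Nat.card (lowerGroup K L m)}

/-- The Herbrand function at a natural number,
`φ_{L/K}(m) = (|G_1| + ⋯ + |G_m|) / |G_0| = ∫_0^m dt / [G_0 : G_t]`. -/
def herbrand (m : ℕ) : ℚ :=
  (∑ k ∈ Finset.Icc 1 m, (Nat.card (lowerGroup K L k) : ℚ)) / Nat.card (lowerGroup K L 0)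

/-- The `i`-th upper ramification break `u_i = φ_{L/K}(b_i)`. -/
def upperBreak (p n i : ℕ) : ℚ := herbrand K L (lowerBreak K L p n i)

end Extension

end LocalRamification

namespace TruncatedWittVector

/-- Apply a function to every coordinate of a Witt vector of length `n`. -/
def mapCoeff (p : ℕ) {n : ℕ} {R S : Type*} (f : R → S) (x : TruncatedWittVector p n R) :
    TruncatedWittVector p n S :=
  TruncatedWittVector.mk p fun i => f (x.coeff i)

end TruncatedWittVector

end

/-!
Write `v` for the valuation of `L`, normalized by `v(L^×) = ℤ`, and `M i` for the fixed field of
`σ ^ p ^ i`, of degree `p ^ i` over `K`. The coefficients `x i` of the Witt vector `x` generate the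
tower `M i` by Artin–Schreier equations `x i ^ p - x i = β i + c i`, where `c i` is the carry into
coefficient `i` of `x + β`. The theorem rests on the value of the `x i`: it is shown that
`v (x i) = -p ^ (n - 1) * m i`, where `m i = u_{i+1}` is the pole order of `β i` over `K`.

*The increments.* Since `p ^ i = V ^ i 1` in Witt vectors of characteristic `p`, the automorphism
`σ ^ p ^ i` adds `1` to the Witt vector `(x i, x (i + 1), …)`. Addition of Witt vectors is isobaric,
which bounds all carries (`WittVector.le_add_coeff`); as the upper breaks grow fast, the increment
of `x (j + 1)` is dominated by a term `D * (x j) ^ (p - 1)`, with `D` the increment of `x j`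
(`WittVector.add_one_coeff_sub_eq_coe`).

*The lower breaks.* A wild automorphism `τ` raises the value of every element of `M` whose value is
prime to `p` by the same amount, its break on `M` (`HasBreak`); by `IsValueIndex.hasBreak` the break
can be read off from one such element. Translating `x i` by an element of `M i` so that the pole of
its constant term becomes prime to `p` yields an element `z` of `M (i + 1)` with
`σ ^ p ^ i - 1` mapping `z` to `1`, which determines the break of `σ ^ p ^ i` on `M (i + 1)`. This
break does not change on passing up the tower (`HasBreak.of_generator`), hence it is `b_{i+1}`.

*The upper breaks.* An element of `K` of pole order `m` prime to `p` becomes, after subtraction of a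
suitable `p`-th power of an element of `M i`, an element with pole order
`p ^ i * m - (p ^ i * u_i - b_i)`, again prime to `p`
(`exists_sub_pow_eq_coe`, `IsBreakSequence.exists_sub_pow_eq_coe`). The hypothesis
`b_{i+1} > p ^ n * u_i` implies that the carry `c i` is negligible against this, so that this pole
order equals `b_{i+1}` (`HasBreak.exists_pole_order`); comparison with the Herbrand function gives
`m i = u_{i+1}`.

The valuation theory of the extension itself is elementary, because the extension is totally
ramified: the powers of a uniformizer form a basis of `L` over `K` whose multiples by elements of
`K` have pairwise distinct values (`exists_uniformizer_expansion`).
-/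

/-! ### Additive valuations with integral values -/

namespace AddValuation

variable {L : Type*} [Field L] (v : AddValuation L (WithTop ℤ))

theorem exists_eq_coe {y : L} (hy : y ≠ 0) : ∃ k : ℤ, v y = (k : WithTop ℤ) := by
  have h : v y ≠ ⊤ := (v.ne_top_iff).2 hy
  exact ⟨_, (WithTop.coe_untop _ h).symm⟩

theorem ne_zero_of_eq_coe {y : L} {k : ℤ} (h : v y = (k : WithTop ℤ)) : y ≠ 0 := by
  rintro rfl
  simp at h

variable {v}

theorem le_mul_coe {x y : L} {a b : ℤ} (hx : (a : WithTop ℤ) ≤ v x) (hy : (b : WithTop ℤ) ≤ v y) :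
    ((a + b : ℤ) : WithTop ℤ) ≤ v (x * y) := by
  rw [v.map_mul, WithTop.coe_add]
  exact add_le_add hx hy

theorem mul_eq_coe {x y : L} {a b : ℤ} (hx : v x = (a : WithTop ℤ)) (hy : v y = (b : WithTop ℤ)) :
    v (x * y) = ((a + b : ℤ) : WithTop ℤ) := by
  rw [v.map_mul, WithTop.coe_add, hx, hy]

theorem inv_eq_coe {x : L} {a : ℤ} (hx : v x = (a : WithTop ℤ)) :
    v x⁻¹ = ((-a : ℤ) : WithTop ℤ) := by
  have h0 := v.ne_zero_of_eq_coe hx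
  obtain ⟨k, hk⟩ := v.exists_eq_coe (inv_ne_zero h0)
  have h := mul_eq_coe hx hk
  rw [mul_inv_cancel₀ h0, v.map_one] at h
  have : a + k = 0 := by exact_mod_cast h.symm
  rw [hk, show k = -a by omega]

theorem pow_eq_coe {x : L} {a : ℤ} (hx : v x = (a : WithTop ℤ)) (m : ℕ) :
    v (x ^ m) = ((m * a : ℤ) : WithTop ℤ) := by
  induction m with
  | zero => simp [v.map_one]
  | succ m ih =>
    rw [pow_succ, mul_eq_coe ih hx]
    congr 1
    push_cast
    ring

theorem le_pow_coe {x : L} {a : ℤ} (hx : (a : WithTop ℤ) ≤ v x) (m : ℕ) :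
    ((m * a : ℤ) : WithTop ℤ) ≤ v (x ^ m) := by
  induction m with
  | zero => simp [v.map_one]
  | succ m ih =>
    rw [pow_succ]
    refine le_trans (le_of_eq ?_) (le_mul_coe ih hx)
    congr 1
    push_cast
    ring

theorem zpow_eq_coe {x : L} {a : ℤ} (hx : v x = (a : WithTop ℤ)) (m : ℤ) :
    v (x ^ m) = ((m * a : ℤ) : WithTop ℤ) := by
  obtain ⟨k, rfl | rfl⟩ := m.eq_nat_or_neg
  · rw [zpow_natCast, pow_eq_coe hx]
  · rw [zpow_neg, zpow_natCast, inv_eq_coe (pow_eq_coe hx k)]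
    congr 1
    ring

theorem add_eq_coe_of_lt {x y : L} {a b : ℤ} (hx : v x = (a : WithTop ℤ))
    (hy : (b : WithTop ℤ) ≤ v y) (hab : a < b) : v (x + y) = (a : WithTop ℤ) := by
  rw [← hx]
  refine v.map_add_eq_of_lt_left ?_
  rw [hx]
  exact lt_of_lt_of_le (by exact_mod_cast hab) hy

theorem le_add_coe {x y : L} {a : ℤ} (hx : (a : WithTop ℤ) ≤ v x) (hy : (a : WithTop ℤ) ≤ v y) :
    (a : WithTop ℤ) ≤ v (x + y) := v.map_le_add hx hy

theorem le_sub_coe {x y : L} {a : ℤ} (hx : (a : WithTop ℤ) ≤ v x) (hy : (a : WithTop ℤ) ≤ v y) :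
    (a : WithTop ℤ) ≤ v (x - y) := by
  rw [sub_eq_add_neg]
  exact v.map_le_add hx (by rwa [v.map_neg])

theorem coe_le_of_le {x : L} {a b : ℤ} (hx : (a : WithTop ℤ) ≤ v x) (hab : b ≤ a) :
    (b : WithTop ℤ) ≤ v x := le_trans (by exact_mod_cast hab) hx

theorem le_eq_coe {x : L} {a b : ℤ} (hx : (a : WithTop ℤ) ≤ v x) (h : v x = (b : WithTop ℤ)) :
    a ≤ b := by
  rw [h] at hx
  exact_mod_cast hx

theorem coe_inj {x : L} {a b : ℤ} (hx : v x = (a : WithTop ℤ)) (h : v x = (b : WithTop ℤ)) :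
    a = b := by
  rw [h] at hx
  exact_mod_cast hx.symm

theorem le_of_le_pow_coe {x : L} {a : ℤ} {m : ℕ} (hm : 0 < m)
    (h : ((m * a : ℤ) : WithTop ℤ) ≤ v (x ^ m)) : (a : WithTop ℤ) ≤ v x := by
  by_cases hx : x = 0
  · simp [hx]
  obtain ⟨k, hk⟩ := v.exists_eq_coe hx
  have := le_eq_coe h (pow_eq_coe hk m)
  rw [hk]
  have : a ≤ k := le_of_mul_le_mul_left this (by exact_mod_cast hm)
  exact_mod_cast this

/-- A lower bound for the values of the solutions of an Artin–Schreier equation. -/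
theorem le_of_artinSchreier {p : ℕ} (hp : 1 < p) {x : L} {a : ℤ} (ha : a ≤ 0)
    (h : ((p * a : ℤ) : WithTop ℤ) ≤ v (x ^ p - x)) : (a : WithTop ℤ) ≤ v x := by
  by_contra hlt
  have hx : x ≠ 0 := by
    rintro rfl
    simp at hlt
  obtain ⟨k, hk⟩ := v.exists_eq_coe hx
  have hka : k < a := by
    rw [hk] at hlt
    exact_mod_cast not_le.1 hlt
  have hp' : (1 : ℤ) < p := by exact_mod_cast hp
  have h1 : v (x ^ p + -x) = ((p * k : ℤ) : WithTop ℤ) :=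
    add_eq_coe_of_lt (pow_eq_coe hk p) (le_of_eq (by rw [v.map_neg, hk])) (by nlinarith)
  rw [← sub_eq_add_neg] at h1
  have := le_eq_coe h h1
  nlinarith

/-- The value of a solution of an Artin–Schreier equation whose constant term has a pole. -/
theorem eq_of_artinSchreier {p : ℕ} (hp : 1 < p) {x : L} {c : ℤ} (hc : c < 0)
    (h : v (x ^ p - x) = (c : WithTop ℤ)) : ∃ a : ℤ, c = p * a ∧ v x = (a : WithTop ℤ) := by
  have hx : x ≠ 0 := by
    rintro rfl
    rw [zero_pow (by omega), sub_zero, v.map_zero] at h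
    simp at h
  obtain ⟨k, hk⟩ := v.exists_eq_coe hx
  have hp' : (1 : ℤ) < p := by exact_mod_cast hp
  have hk0 : k < 0 := by
    by_contra hk0
    have h0 : ((0 : ℤ) : WithTop ℤ) ≤ v x := by
      rw [hk]
      exact_mod_cast not_lt.1 hk0
    have := le_eq_coe (le_sub_coe (coe_le_of_le (le_pow_coe h0 p) (by simp)) h0) h
    omega
  have h1 : v (x ^ p + -x) = ((p * k : ℤ) : WithTop ℤ) :=
    add_eq_coe_of_lt (pow_eq_coe hk p) (le_of_eq (by rw [v.map_neg, hk])) (by nlinarith)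
  rw [← sub_eq_add_neg] at h1
  exact ⟨k, coe_inj h h1, hk⟩

end AddValuation

/-- The additive valuation `v` of `L` takes on `M^×` precisely the multiples of `e`. -/
def IsValueIndex {K L : Type*} [Field K] [Field L] [Algebra K L] (v : AddValuation L (WithTop ℤ))
    (M : IntermediateField K L) (e : ℤ) : Prop :=
  (∃ t ∈ M, v t = (e : WithTop ℤ)) ∧ ∀ y ∈ M, y ≠ 0 → ∃ k : ℤ, v y = ((e * k : ℤ) : WithTop ℤ)

/-- The residue field of `v` is finite of characteristic `p`. This is expressed in terms of `v`: for
some power `q = p ^ (f + 1)`, all elements `y` of the valuation ring satisfy `y ^ q ≡ y` modulo the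
maximal ideal. -/
def HasFiniteResidue {L : Type*} [Field L] (p : ℕ) (v : AddValuation L (WithTop ℤ)) : Prop :=
  ∃ f : ℕ, ∀ y : L, ((0 : ℤ) : WithTop ℤ) ≤ v y → ((1 : ℤ) : WithTop ℤ) ≤ v (y ^ p ^ (f + 1) - y)

namespace IsValueIndex

open AddValuation

variable {K L : Type*} [Field K] [Field L] [Algebra K L] {v : AddValuation L (WithTop ℤ)}
  {M : IntermediateField K L} {e : ℤ}

theorem le_of_lt (hM : IsValueIndex v M e) (he : 0 < e) {y : L} (hy : y ∈ M) {k : ℤ}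
    (h : ((e * k + 1 : ℤ) : WithTop ℤ) ≤ v y) : ((e * (k + 1) : ℤ) : WithTop ℤ) ≤ v y := by
  by_cases hy0 : y = 0
  · simp [hy0]
  obtain ⟨l, hl⟩ := hM.2 y hy hy0
  have h1 := le_eq_coe h hl
  have h2 : k < l := lt_of_mul_lt_mul_left (by omega : e * k < e * l) he.le
  rw [hl]
  have : e * (k + 1) ≤ e * l := mul_le_mul_of_nonneg_left (by omega) he.le
  exact_mod_cast this

/-- If the value of `z` is prime to `p` in the value group of `M`, every element of `M` agrees with
a monomial `z ^ l * g ^ p` up to terms of higher order. -/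
theorem exists_monomial_approx {p : ℕ} (hp : p.Prime) (hres : HasFiniteResidue p v)
    (hM : IsValueIndex v M e) (he : 0 < e) {z : L} (hz : z ∈ M) {s : ℤ}
    (hzs : v z = ((e * s : ℤ) : WithTop ℤ)) (hs : ¬ (p : ℤ) ∣ s) {y : L} (hy : y ∈ M) {k : ℤ}
    (hyk : v y = ((e * k : ℤ) : WithTop ℤ)) :
    ∃ l < p, ∃ g ∈ M, ∃ h : ℤ, v g = ((e * h : ℤ) : WithTop ℤ) ∧ l * s + p * h = k ∧
      ((e * (k + 1) : ℤ) : WithTop ℤ) ≤ v (y - z ^ l * g ^ p) := by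
  have hp0 : (0 : ℤ) < p := by exact_mod_cast hp.pos
  -- `l` solves `l * s ≡ k` modulo `p`
  obtain ⟨a, b, hab⟩ : IsCoprime (p : ℤ) s :=
    (Prime.coprime_iff_not_dvd (Nat.prime_iff_prime_int.1 hp)).2 hs
  obtain ⟨l, hl⟩ := Int.eq_ofNat_of_zero_le (Int.emod_nonneg (k * b) hp0.ne')
  have hlp : l < p := by
    have := Int.emod_lt_of_pos (k * b) hp0
    omega
  obtain ⟨h, hh⟩ : (p : ℤ) ∣ k - l * s := by
    refine ⟨k * a + (k * b / p) * s, ?_⟩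
    have h1 := Int.emod_add_mul_ediv (k * b) p
    rw [hl] at h1
    have h2 : k * (a * p + b * s) = k := by rw [hab, mul_one]
    linear_combination -h2 - s * h1
  obtain ⟨t, ht, hte⟩ := hM.1
  obtain ⟨f, hf⟩ := hres
  have hz0 := v.ne_zero_of_eq_coe hzs
  have ht0 := v.ne_zero_of_eq_coe hte
  have hth := zpow_eq_coe hte h
  have hmon := mul_eq_coe (pow_eq_coe hzs l) (pow_eq_coe hth p)
  have hmon0 := v.ne_zero_of_eq_coe hmon
  have hval : (l : ℤ) * (e * s) + p * (h * e) = e * k := by linear_combination -e * hh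
  rw [hval] at hmon
  set w := y * (z ^ l * (t ^ h) ^ p)⁻¹ with hw
  have hwM : w ∈ M := mul_mem hy (inv_mem (mul_mem (pow_mem hz l) (pow_mem (zpow_mem ht h) p)))
  have hwv : v w = ((0 : ℤ) : WithTop ℤ) := by
    rw [hw, mul_eq_coe hyk (inv_eq_coe hmon), add_neg_cancel]
  have hg := mul_eq_coe hth (pow_eq_coe hwv (p ^ f))
  refine ⟨l, hlp, t ^ h * w ^ p ^ f, mul_mem (zpow_mem ht h) (pow_mem hwM _), h, ?_, by omega, ?_⟩
  · rw [hg]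
    congr 1
    ring
  · have hyw : y - z ^ l * (t ^ h * w ^ p ^ f) ^ p =
        -((z ^ l * (t ^ h) ^ p) * (w ^ p ^ (f + 1) - w)) := by
      have : y = w * (z ^ l * (t ^ h) ^ p) := by rw [hw, inv_mul_cancel_right₀ hmon0]
      rw [this, pow_succ p f, pow_mul]
      ring
    refine hM.le_of_lt he (sub_mem hy (mul_mem (pow_mem hz l)
      (pow_mem (mul_mem (zpow_mem ht h) (pow_mem hwM _)) p))) ?_
    rw [hyw, v.map_neg]
    exact le_mul_coe hmon.ge (hf w hwv.ge)

/-- An element of `M` whose value is divisible by `p` in the value group of `M` agrees with a `p`-th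
power up to terms of higher order. -/
theorem exists_pow_approx {p : ℕ} (hp : p.Prime) (hres : HasFiniteResidue p v)
    (hM : IsValueIndex v M e) (he : 0 < e) {y : L} (hy : y ∈ M) {k : ℤ}
    (hyk : v y = ((e * (p * k) : ℤ) : WithTop ℤ)) :
    ∃ g ∈ M, v g = ((e * k : ℤ) : WithTop ℤ) ∧
      ((e * (p * k + 1) : ℤ) : WithTop ℤ) ≤ v (y - g ^ p) := by
  obtain ⟨t, ht, hte⟩ := hM.1
  obtain ⟨l, hl, g, hg, h, hgh, hk, hle⟩ := hM.exists_monomial_approx hp hres he ht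
    (s := 1) (by rw [mul_one, hte]) (fun h ↦ hp.one_lt.ne' (Nat.dvd_one.1 (by exact_mod_cast h)))
    hy hyk
  have hpl : (p : ℤ) ∣ l := ⟨k - h, by linear_combination hk⟩
  have hl0 : l = 0 := Nat.eq_zero_of_dvd_of_lt (by exact_mod_cast hpl) hl
  subst hl0
  have hp0 : (p : ℤ) ≠ 0 := by exact_mod_cast hp.ne_zero
  have : h = k := mul_left_cancel₀ hp0 (by linear_combination hk)
  subst this
  exact ⟨g, hg, hgh, by simpa using hle⟩

end IsValueIndex

/-! ### Wild automorphisms and ramification breaks -/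

section

namespace AddValuation

variable {L : Type*} [Field L] {v : AddValuation L (WithTop ℤ)}

theorem zero_le_natCast (m : ℕ) : ((0 : ℤ) : WithTop ℤ) ≤ v (m : L) := by
  induction m with
  | zero => simp
  | succ m ih =>
    rw [Nat.cast_succ]
    exact le_add_coe ih (by rw [v.map_one]; rfl)

theorem natCast_eq_zero {p : ℕ} (hp : p.Prime) [CharP L p] {m : ℕ} (hm : ¬ p ∣ m) :
    v (m : L) = ((0 : ℤ) : WithTop ℤ) := by
  have : Fact p.Prime := ⟨hp⟩
  have h0 : (m : L) ≠ 0 := by rwa [Ne, CharP.cast_eq_zero_iff L p]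
  have h1 : (m : L) ^ (p - 1) = 1 := by
    have h2 : (m : ZMod p) ≠ 0 := by rwa [Ne, CharP.cast_eq_zero_iff (ZMod p) p]
    have := congrArg (ZMod.castHom dvd_rfl L) (ZMod.pow_card_sub_one_eq_one h2)
    simpa using this
  obtain ⟨k, hk⟩ := v.exists_eq_coe h0
  have h3 := pow_eq_coe hk (p - 1)
  rw [h1, v.map_one] at h3
  have h4 : ((p - 1 : ℕ) : ℤ) * k = 0 := by exact_mod_cast h3.symm
  have h5 : ((p - 1 : ℕ) : ℤ) ≠ 0 := by
    have := hp.one_lt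
    omega
  rw [hk, (mul_eq_zero.1 h4).resolve_left h5]

/-- The binomial expansion of `(z + d) ^ m` to first order. -/
theorem le_add_pow_sub {z d : L} {a c : ℤ} (hz : (a : WithTop ℤ) ≤ v z)
    (hd : ((a + c : ℤ) : WithTop ℤ) ≤ v d) (hc : 1 ≤ c) (m : ℕ) :
    (((m + 1) * a + c + 1 : ℤ) : WithTop ℤ) ≤
      v ((z + d) ^ (m + 1) - z ^ (m + 1) - (m + 1 : ℕ) * z ^ m * d) := by
  induction m with
  | zero => simp
  | succ m ih =>
    have h1 : (z + d) ^ (m + 1 + 1) - z ^ (m + 1 + 1) - (m + 1 + 1 : ℕ) * z ^ (m + 1) * d =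
        z * ((z + d) ^ (m + 1) - z ^ (m + 1) - (m + 1 : ℕ) * z ^ m * d) +
        d * (((z + d) ^ (m + 1) - z ^ (m + 1) - (m + 1 : ℕ) * z ^ m * d) +
          (m + 1 : ℕ) * z ^ m * d) := by
      push_cast
      ring
    rw [h1]
    refine le_add_coe (coe_le_of_le (le_mul_coe hz ih) ?_) (coe_le_of_le (le_mul_coe hd
      (le_add_coe (coe_le_of_le ih (b := (m + 1) * a + c) ?_)
        (coe_le_of_le (le_mul_coe (le_mul_coe (zero_le_natCast (m + 1)) (le_pow_coe hz m)) hd)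
          ?_))) ?_) <;> push_cast <;> nlinarith

end AddValuation

open AddValuation

/-- `τ` is wildly ramified: `τ - 1` raises all values. -/
def IsWild {K L : Type*} [Field K] [Field L] [Algebra K L] (v : AddValuation L (WithTop ℤ))
    (τ : L ≃ₐ[K] L) : Prop :=
  ∀ (y : L) (k : ℤ), (k : WithTop ℤ) ≤ v y → ((k + 1 : ℤ) : WithTop ℤ) ≤ v (τ y - y)

namespace IsWild

variable {K L : Type*} [Field K] [Field L] [Algebra K L] {v : AddValuation L (WithTop ℤ)}
  {τ : L ≃ₐ[K] L}

theorem map_eq (hτ : IsWild v τ) (y : L) : v (τ y) = v y := by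
  by_cases hy : y = 0
  · simp [hy]
  obtain ⟨k, hk⟩ := v.exists_eq_coe hy
  rw [hk, ← add_sub_cancel y (τ y)]
  exact add_eq_coe_of_lt hk (hτ y k hk.ge) (by omega)

theorem pow (hτ : IsWild v τ) (m : ℕ) : IsWild v (τ ^ m) := by
  induction m with
  | zero =>
    intro y k _
    simp
  | succ m ih =>
    intro y k hk
    have h : (τ ^ (m + 1)) y - y = ((τ ^ m) (τ y) - τ y) + (τ y - y) := by
      rw [pow_succ, AlgEquiv.mul_apply]
      ring
    rw [h]
    exact le_add_coe (ih _ k (by rwa [hτ.map_eq])) (hτ y k hk)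

/-- In characteristic `p`, the exponents divisible by `p` give strictly deeper ramification:
`τ ^ m - 1` is the sum of the `τ ^ j` with `j < m`, applied to `τ - 1`, and these `m` terms agree
to first order. -/
theorem le_pow_sub {p : ℕ} [CharP L p] (hτ : IsWild v τ) {z : L} {a : ℤ}
    (h : (a : WithTop ℤ) ≤ v (τ z - z)) {m : ℕ} (hm : p ∣ m) :
    ((a + 1 : ℤ) : WithTop ℤ) ≤ v ((τ ^ m) z - z) := by
  have h1 : (τ ^ m) z - z =
      ∑ j ∈ Finset.range m, ((τ ^ j) (τ z - z) - (τ z - z)) := by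
    have h2 := Finset.sum_range_sub (fun j ↦ (τ ^ j) z) m
    rw [Finset.sum_sub_distrib, Finset.sum_const, Finset.card_range, nsmul_eq_mul,
      (CharP.cast_eq_zero_iff L p m).2 hm, zero_mul, sub_zero]
    rw [pow_zero, AlgEquiv.one_apply] at h2
    rw [← h2]
    refine Finset.sum_congr rfl fun j _ ↦ ?_
    rw [pow_succ, AlgEquiv.mul_apply, _root_.map_sub]
  rw [h1]
  exact v.map_le_sum fun j _ ↦ hτ.pow j _ a h

end IsWild

/-- `τ` has ramification break `b` on `M`, whose value group is generated by `e`: applying `τ - 1`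
raises values by at least `e * b`, and by exactly `e * b` on elements whose value is prime to `p` in
the value group of `M`. -/
def HasBreak {K L : Type*} [Field K] [Field L] [Algebra K L] (p : ℕ)
    (v : AddValuation L (WithTop ℤ)) (M : IntermediateField K L) (e : ℤ)
    (τ : L ≃ₐ[K] L) (b : ℤ) : Prop :=
  (∀ y ∈ M, ∀ k : ℤ, ((e * k : ℤ) : WithTop ℤ) ≤ v y →
    ((e * (k + b) : ℤ) : WithTop ℤ) ≤ v (τ y - y)) ∧
  ∀ y ∈ M, ∀ k : ℤ, ¬ (p : ℤ) ∣ k → v y = ((e * k : ℤ) : WithTop ℤ) →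
    v (τ y - y) = ((e * (k + b) : ℤ) : WithTop ℤ)

section

variable {K L : Type*} [Field K] [Field L] [Algebra K L] {v : AddValuation L (WithTop ℤ)}
  {M : IntermediateField K L} {e : ℤ} {p : ℕ}

/-- The ramification break of an automorphism can be read off from a single element whose value is
prime to `p`. -/
theorem IsValueIndex.hasBreak [CharP L p] (hM : IsValueIndex v M e) (hp : p.Prime)
    (hres : HasFiniteResidue p v) (he : 0 < e) {τ : L ≃ₐ[K] L} (hτM : ∀ y ∈ M, τ y ∈ M)
    (hτ : IsWild v τ)
    {z : L} (hz : z ∈ M) {s b : ℤ} (hs : ¬ (p : ℤ) ∣ s) (hzs : v z = ((e * s : ℤ) : WithTop ℤ))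
    (hzb : v (τ z - z) = ((e * (s + b) : ℤ) : WithTop ℤ)) : HasBreak p v M e τ b := by
  have : Fact p.Prime := ⟨hp⟩
  have hp2 : (2 : ℤ) ≤ p := by exact_mod_cast hp.two_le
  have hb : 1 ≤ b := by
    have h1 := le_eq_coe (hτ z _ hzs.ge) hzb
    have h2 : 0 < e * b := by linarith
    have := pos_of_mul_pos_right h2 he.le
    omega
  have heb : 1 ≤ e * b := by nlinarith
  -- powers of `z`
  have hpow : ∀ l : ℕ, (((l * (e * s) + e * b : ℤ) : WithTop ℤ) ≤ v (τ z ^ l - z ^ l)) ∧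
      (¬ p ∣ l → v (τ z ^ l - z ^ l) = ((l * (e * s) + e * b : ℤ) : WithTop ℤ)) := by
    rintro (_ | m)
    · simp
    have h1 := le_add_pow_sub (v := v) hzs.ge (d := τ z - z) (c := e * b)
      (by rw [hzb, mul_add]) heb m
    have h2 : τ z ^ (m + 1) - z ^ (m + 1) = (m + 1 : ℕ) * z ^ m * (τ z - z) +
        ((z + (τ z - z)) ^ (m + 1) - z ^ (m + 1) - (m + 1 : ℕ) * z ^ m * (τ z - z)) := by
      rw [add_sub_cancel]
      ring
    rw [h2]
    constructor
    · refine le_add_coe (coe_le_of_le (le_mul_coe (le_mul_coe (zero_le_natCast (m + 1))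
        (le_pow_coe hzs.ge m)) hzb.ge) ?_) (coe_le_of_le h1 ?_)
      · push_cast
        linarith
      · push_cast
        linarith
    · intro hpm
      have h3 := mul_eq_coe (mul_eq_coe (natCast_eq_zero (v := v) hp hpm)
        (pow_eq_coe hzs m)) hzb
      have h4 : 0 + (m : ℤ) * (e * s) + e * (s + b) = ((m + 1 : ℕ) : ℤ) * (e * s) + e * b := by
        push_cast
        ring
      rw [h4] at h3
      refine add_eq_coe_of_lt h3 h1 ?_
      push_cast
      linarith
  have hdecomp : ∀ (l : ℕ) (g y : L), τ y - y = (τ z ^ l - z ^ l) * g ^ p +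
      (τ z ^ l * (τ g - g) ^ p + (τ (y - z ^ l * g ^ p) - (y - z ^ l * g ^ p))) := by
    intro l g y
    rw [sub_pow_char]
    simp only [_root_.map_sub, _root_.map_mul, _root_.map_pow]
    ring
  have hτz : v (τ z) = ((e * s : ℤ) : WithTop ℤ) := by rw [hτ.map_eq, hzs]
  -- the remaining two terms are negligible as soon as `τ - 1` raises values by `e * c`, `c ≥ 1`
  have hrest : ∀ c : ℕ, 1 ≤ c →
      (∀ y ∈ M, ∀ k : ℤ, ((e * k : ℤ) : WithTop ℤ) ≤ v y →
        ((e * (k + c) : ℤ) : WithTop ℤ) ≤ v (τ y - y)) →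
      ∀ (l : ℕ) (g y : L) (h k : ℤ), g ∈ M → y ∈ M → v g = ((e * h : ℤ) : WithTop ℤ) →
        l * s + p * h = k → ((e * (k + 1) : ℤ) : WithTop ℤ) ≤ v (y - z ^ l * g ^ p) →
        ((e * (k + (c + 1)) : ℤ) : WithTop ℤ) ≤ v (τ z ^ l * (τ g - g) ^ p +
          (τ (y - z ^ l * g ^ p) - (y - z ^ l * g ^ p))) := by
    intro c hc ih l g y h k hg hy hgh hk hle
    have hc' : (1 : ℤ) ≤ c := by exact_mod_cast hc
    refine le_add_coe (coe_le_of_le (le_mul_coe (le_pow_coe hτz.ge l)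
      (le_pow_coe (ih g hg h hgh.ge) p)) ?_) (coe_le_of_le (ih _ (sub_mem hy
        (mul_mem (pow_mem hz l) (pow_mem hg p))) _ hle) ?_)
    · have : (l : ℤ) * (e * s) + p * (e * (h + c)) = e * (k + p * c) := by
        rw [← hk]
        ring
      rw [this]
      refine mul_le_mul_of_nonneg_left ?_ he.le
      nlinarith
    · exact le_of_eq (by ring)
  have hclaim : ∀ c : ℕ, 1 ≤ c → (c : ℤ) ≤ b → ∀ y ∈ M, ∀ k : ℤ,
      ((e * k : ℤ) : WithTop ℤ) ≤ v y → ((e * (k + c) : ℤ) : WithTop ℤ) ≤ v (τ y - y) := by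
    intro c hc
    induction c, hc using Nat.le_induction with
    | base =>
      intro _ y hy k hk
      exact hM.le_of_lt he (sub_mem (hτM y hy) hy) (hτ y _ hk)
    | succ c hc ih =>
      intro hcb y hy k hk
      push_cast at hcb ⊢
      by_cases hy0 : y = 0
      · simp [hy0]
      obtain ⟨k', hk'⟩ := hM.2 y hy hy0
      have hkk : k ≤ k' := le_of_mul_le_mul_left (le_eq_coe hk hk') he
      obtain ⟨l, -, g, hg, h, hgh, hlk, hle⟩ :=
        hM.exists_monomial_approx hp hres he hz hzs hs hy hk'
      refine coe_le_of_le (a := e * (k' + (c + 1))) ?_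
        (mul_le_mul_of_nonneg_left (show k + ((c : ℤ) + 1) ≤ k' + (c + 1) by omega) he.le)
      rw [hdecomp l g y]
      refine le_add_coe (coe_le_of_le (le_mul_coe (hpow l).1 (le_pow_coe hgh.ge p)) ?_)
        (hrest c hc (ih (by omega)) l g y h k' hg hy hgh hlk hle)
      have : (l : ℤ) * (e * s) + e * b + p * (e * h) = e * (k' + b) := by
        rw [← hlk]
        ring
      rw [this]
      exact mul_le_mul_of_nonneg_left (by omega) he.le
  obtain ⟨c, rfl⟩ := Int.eq_ofNat_of_zero_le (by omega : 0 ≤ b)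
  have hc : 1 ≤ c := by exact_mod_cast hb
  refine ⟨hclaim c hc le_rfl, fun y hy k hk hyk ↦ ?_⟩
  obtain ⟨l, hl, g, hg, h, hgh, hlk, hle⟩ := hM.exists_monomial_approx hp hres he hz hzs hs hy hyk
  have hpl : ¬ p ∣ l := fun hpl ↦ hk (by
    rw [← hlk]
    exact dvd_add (dvd_mul_of_dvd_left (by exact_mod_cast hpl) s) (dvd_mul_right _ _))
  rw [hdecomp l g y]
  have h1 := mul_eq_coe ((hpow l).2 hpl) (pow_eq_coe hgh p)
  have h2 : (l : ℤ) * (e * s) + e * c + p * (e * h) = e * (k + c) := by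
    rw [← hlk]
    ring
  rw [h2] at h1
  refine add_eq_coe_of_lt h1 (hrest c hc (hclaim c hc le_rfl) l g y h k hg hy hgh hlk hle) ?_
  nlinarith

end

end

/-! ### Artin–Schreier extensions -/

section

open AddValuation

section

variable {K L : Type*} [Field K] [Field L] [Algebra K L] {v : AddValuation L (WithTop ℤ)}
  {M M' : IntermediateField K L} {e : ℤ} {p : ℕ}

/-- A generator of an Artin–Schreier extension of `M` can be translated by an element of `M` so that
the pole order of its constant term becomes prime to `p`. -/
theorem IsValueIndex.exists_reduced_generator [CharP L p] (hM : IsValueIndex v M (p * e))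
    (hp : p.Prime) (hres : HasFiniteResidue p v) (he : 0 < e) {τ : L ≃ₐ[K] L} (hτ : IsWild v τ)
    (hfix : ∀ y ∈ M, τ y = y) {x : L} (hx : x ^ p - x ∈ M) (hτx : τ x = x + 1) :
    ∃ γ ∈ M, ∃ b : ℤ, 0 < b ∧ ¬ (p : ℤ) ∣ b ∧
      v ((x - γ) ^ p - (x - γ)) = ((p * e * -b : ℤ) : WithTop ℤ) ∧
      v (x - γ) = ((e * -b : ℤ) : WithTop ℤ) := by
  have : Fact p.Prime := ⟨hp⟩
  have hp2 : (2 : ℤ) ≤ p := by exact_mod_cast hp.two_le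
  have hpe : 0 < p * e := by positivity
  have key : ∀ (N : ℕ) (x : L), x ^ p - x ∈ M → τ x = x + 1 →
      ((p * e * -N : ℤ) : WithTop ℤ) ≤ v (x ^ p - x) →
      ∃ γ ∈ M, ∃ b : ℤ, 0 < b ∧ ¬ (p : ℤ) ∣ b ∧
        v ((x - γ) ^ p - (x - γ)) = ((p * e * -b : ℤ) : WithTop ℤ) ∧
        v (x - γ) = ((e * -b : ℤ) : WithTop ℤ) := by
    intro N
    induction N with
    | zero =>
      intro x _ hτx hN
      -- an integral `x` would be fixed by `τ` modulo the maximal ideal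
      have h1 := hτ x 0 (le_of_artinSchreier hp.one_lt le_rfl (by simpa using hN))
      rw [hτx, add_sub_cancel_left] at h1
      have := le_eq_coe h1 (b := 0) (by rw [v.map_one]; rfl)
      omega
    | succ N ih =>
      intro x hx hτx hN
      by_cases h0 : x ^ p - x = 0
      · exact ih x hx hτx (by simp [h0])
      obtain ⟨k, hk⟩ := hM.2 _ hx h0
      have hNk : -(N + 1 : ℤ) ≤ k := le_of_mul_le_mul_left (by simpa using le_eq_coe hN hk) hpe
      by_cases hkN : -(N : ℤ) ≤ k
      · exact ih x hx hτx (hk ▸ by exact_mod_cast mul_le_mul_of_nonneg_left hkN hpe.le)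
      have hk0 : k < 0 := by omega
      by_cases hpk : (p : ℤ) ∣ k
      · obtain ⟨j, rfl⟩ := hpk
        obtain ⟨g, hg, hgj, hle⟩ := hM.exists_pow_approx hp hres hpe hx hk
        have hxg : (x - g) ^ p - (x - g) = (x ^ p - x - g ^ p) + g := by
          rw [sub_pow_char]
          ring
        have hj : j < 0 := by nlinarith
        obtain ⟨γ, hγ, b, hb⟩ := ih (x - g)
          (hxg ▸ add_mem (sub_mem hx (pow_mem hg p)) hg)
          (by rw [_root_.map_sub, hτx, hfix g hg]; ring)
          (by
            rw [hxg]
            refine le_add_coe (coe_le_of_le hle ?_) (coe_le_of_le hgj.ge ?_)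
            · exact mul_le_mul_of_nonneg_left (by omega) hpe.le
            · refine mul_le_mul_of_nonneg_left ?_ hpe.le
              nlinarith)
        exact ⟨g + γ, add_mem hg hγ, b, by rwa [← sub_sub]⟩
      · obtain ⟨a, ha, hxa⟩ := eq_of_artinSchreier hp.one_lt (by nlinarith) hk
        have : a = e * k := mul_left_cancel₀ (by omega : (p : ℤ) ≠ 0) (by linarith)
        refine ⟨0, zero_mem M, -k, by omega, by rwa [dvd_neg], ?_, ?_⟩
        · rw [sub_zero, neg_neg, hk]
        · rw [sub_zero, neg_neg, hxa, this]
  by_cases h0 : x ^ p - x = 0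
  · exact key 0 x hx hτx (by simp [h0])
  obtain ⟨k, hk⟩ := hM.2 _ hx h0
  refine key k.natAbs x hx hτx ?_
  rw [hk]
  exact_mod_cast mul_le_mul_of_nonneg_left (neg_abs_le k) hpe.le

/-- The break of `τ` on `M` lies strictly below the break of an Artin–Schreier extension of `M` on
which a power of `τ` generates the Galois group. -/
theorem HasBreak.lt_of_generator [CharP L p] (hp : p.Prime) (he : 0 < e) {τ : L ≃ₐ[K] L} {b b' : ℤ}
    (hb : HasBreak p v M (p * e) τ b) (hτ : IsWild v τ) {z : L} (hz : z ^ p - z ∈ M)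
    (hb' : ¬ (p : ℤ) ∣ b') (hzb : v (z ^ p - z) = ((p * e * -b' : ℤ) : WithTop ℤ)) {m : ℕ}
    (hm : p ∣ m) (hτz : (τ ^ m) z = z + 1) : b < b' := by
  have : Fact p.Prime := ⟨hp⟩
  by_contra hlt
  have h1 := hb.2 _ hz (-b') (by rwa [dvd_neg]) hzb
  have h2 : τ (z ^ p - z) - (z ^ p - z) = (τ z - z) ^ p - (τ z - z) := by
    rw [sub_pow_char, _root_.map_sub, _root_.map_pow]
    ring
  rw [h2] at h1
  have hp0 : (0 : ℤ) < p := by exact_mod_cast hp.pos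
  have h3 := hτ.le_pow_sub (le_of_artinSchreier hp.one_lt le_rfl (coe_le_of_le h1.ge (by
    have : 0 ≤ p * e * (-b' + b) := mul_nonneg (by positivity) (by omega)
    simpa using this))) hm
  rw [hτz, add_sub_cancel_left] at h3
  have := le_eq_coe h3 (b := 0) (by rw [v.map_one]; rfl)
  omega

/-- A break of `τ` on `M` persists on an Artin–Schreier extension of `M` with a larger break. -/
theorem HasBreak.of_generator [CharP L p] (hp : p.Prime) (hres : HasFiniteResidue p v) (he : 0 < e)
    {τ : L ≃ₐ[K] L} {b b' : ℤ} (hb : HasBreak p v M (p * e) τ b) (hτ : IsWild v τ)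
    (hM' : IsValueIndex v M' e) (hτM' : ∀ y ∈ M', τ y ∈ M') {z : L} (hzM : z ∈ M')
    (hz : z ^ p - z ∈ M) (hb' : ¬ (p : ℤ) ∣ b')
    (hzb : v (z ^ p - z) = ((p * e * -b' : ℤ) : WithTop ℤ))
    (hzv : v z = ((e * -b' : ℤ) : WithTop ℤ)) (hbb : b < b') : HasBreak p v M' e τ b := by
  have : Fact p.Prime := ⟨hp⟩
  refine hM'.hasBreak hp hres he hτM' hτ hzM (s := -b') (by rwa [dvd_neg]) hzv ?_
  have h1 := hb.2 _ hz (-b') (by rwa [dvd_neg]) hzb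
  have h2 : τ (z ^ p - z) - (z ^ p - z) = (τ z - z) ^ p - (τ z - z) := by
    rw [sub_pow_char, _root_.map_sub, _root_.map_pow]
    ring
  rw [h2] at h1
  have hp0 : (0 : ℤ) < p := by exact_mod_cast hp.pos
  obtain ⟨a, ha, hza⟩ := eq_of_artinSchreier hp.one_lt
    (mul_neg_of_pos_of_neg (by positivity) (by omega)) h1
  rw [hza, mul_left_cancel₀ hp0.ne' (show (p : ℤ) * a = p * (e * (-b' + b)) by linarith)]

section Approximation

variable [CharP L p] (hp : p.Prime) (hres : HasFiniteResidue p v) (he : 0 < e)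
  (hM : IsValueIndex v M (p * e)) (hMM' : M ≤ M') {z : L} (hzM : z ∈ M')
  (hz : z ^ p - z ∈ M) {b : ℤ} (hb0 : 0 < b) (hb : ¬ (p : ℤ) ∣ b)
  (hzb : v (z ^ p - z) = ((p * e * -b : ℤ) : WithTop ℤ))
  (hzv : v z = ((e * -b : ℤ) : WithTop ℤ))

include hp hres he hM hMM' hzM hz hb0 hb hzb hzv

/-- Subtracting a `p`-th power of the Artin–Schreier extension `M'` from the leading term of an
element of `M`. -/
theorem exists_sub_pow_eq {r : L} (hr : r ∈ M) {a : ℤ}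
    (hra : v r = ((p * e * a : ℤ) : WithTop ℤ)) :
    ∃ g ∈ M', ∃ r' ∈ M, ∃ w : L, r - g ^ p = r' + w ∧
      v (g ^ p) = ((p * e * a : ℤ) : WithTop ℤ) ∧
      ((p * e * (a + 1) : ℤ) : WithTop ℤ) ≤ v r' ∧
      ((e * (p * a + (p - 1) * b) : ℤ) : WithTop ℤ) ≤ v w ∧
      (¬ (p : ℤ) ∣ a → v w = ((e * (p * a + (p - 1) * b) : ℤ) : WithTop ℤ)) := by
  have : Fact p.Prime := ⟨hp⟩
  have hp2 : (2 : ℤ) ≤ p := by exact_mod_cast hp.two_le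
  have hpe : 0 < p * e := by positivity
  obtain ⟨l, hl, g, hg, h, hgh, hlk, hle⟩ := hM.exists_monomial_approx hp hres hpe hz hzb
    (by rwa [dvd_neg]) hr hra
  refine ⟨z ^ l * g, mul_mem (pow_mem hzM l) (hMM' hg), r - (z ^ p - z) ^ l * g ^ p,
    sub_mem hr (mul_mem (pow_mem hz l) (pow_mem hg p)),
    ((z ^ p - z) ^ l - (z ^ p) ^ l) * g ^ p, by ring, ?_, hle, ?_⟩
  · rw [pow_eq_coe (mul_eq_coe (pow_eq_coe hzv l) hgh), ← hlk]
    congr 1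
    ring
  have hgp := pow_eq_coe hgh p
  rcases l with _ | m
  · have ha : (p : ℤ) ∣ a := ⟨h, by rw [← hlk]; simp⟩
    simp [ha]
  have hc : 1 ≤ (p - 1) * (e * b) := by
    have : 0 < e * b := by positivity
    nlinarith
  have h1 := le_add_pow_sub (v := v) (pow_eq_coe hzv p).ge (d := -z) (c := (p - 1) * (e * b))
    (by
      rw [v.map_neg, hzv]
      refine le_of_eq ?_
      congr 1
      ring) hc m
  have h2 : (z ^ p - z) ^ (m + 1) - (z ^ p) ^ (m + 1) = (m + 1 : ℕ) * (z ^ p) ^ m * -z +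
      ((z ^ p + -z) ^ (m + 1) - (z ^ p) ^ (m + 1) - (m + 1 : ℕ) * (z ^ p) ^ m * -z) := by
    ring
  have h3 : v (-z) = ((e * -b : ℤ) : WithTop ℤ) := by rw [v.map_neg, hzv]
  rw [h2]
  constructor
  · refine coe_le_of_le (le_mul_coe (le_add_coe (coe_le_of_le (le_mul_coe (le_mul_coe
      (zero_le_natCast (m + 1)) (pow_eq_coe (pow_eq_coe hzv p) m).ge) h3.ge)
        (b := (m + 1) * (p * (e * -b)) + (p - 1) * (e * b)) ?_) (coe_le_of_le h1 ?_)) hgp.ge) ?_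
    · linarith
    · linarith
    · rw [← hlk]
      push_cast
      linarith
  · intro hpa
    have hpm : ¬ p ∣ m + 1 := fun hpm ↦ hpa (by
      rw [← hlk]
      exact dvd_add (dvd_mul_of_dvd_left (by exact_mod_cast hpm) _) (dvd_mul_right _ _))
    have h4 := add_eq_coe_of_lt (mul_eq_coe (mul_eq_coe (natCast_eq_zero (v := v) hp hpm)
      (pow_eq_coe (pow_eq_coe hzv p) m)) h3) h1 (by linarith)
    rw [mul_eq_coe h4 hgp, ← hlk]
    congr 1
    push_cast
    ring

/-- Up to a given precision `N`, subtracting a `p`-th power of `M'` raises the value of any element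
of `M` by `(p - 1) * b`. The bound `j` for the distance to `N` serves as induction variable. -/
theorem exists_le_sub_pow (N : ℤ) (j : ℕ) : ∀ a : ℤ, N ≤ p * e * a + j → ∀ r ∈ M,
    ((p * e * a : ℤ) : WithTop ℤ) ≤ v r →
    ∃ γ ∈ M', ((p * e * a : ℤ) : WithTop ℤ) ≤ v (γ ^ p) ∧
      ((min N (e * (p * a + (p - 1) * b)) : ℤ) : WithTop ℤ) ≤ v (r - γ ^ p) := by
  have : Fact p.Prime := ⟨hp⟩
  have hp2 : (2 : ℤ) ≤ p := by exact_mod_cast hp.two_le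
  have hpe : 0 < p * e := by positivity
  induction j with
  | zero =>
    intro a ha r hr hra
    refine ⟨0, zero_mem _, by simp [hp.ne_zero], ?_⟩
    rw [zero_pow hp.ne_zero, sub_zero]
    exact coe_le_of_le hra ((min_le_left _ _).trans (by simpa using ha))
  | succ j ih =>
    intro a ha r hr hra
    have hN : N ≤ p * e * (a + 1) + j := by
      push_cast at ha
      linarith
    have hmin : min N (e * (p * a + (p - 1) * b)) ≤ min N (e * (p * (a + 1) + (p - 1) * b)) := by
      refine min_le_min le_rfl (mul_le_mul_of_nonneg_left ?_ he.le)
      linarith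
    have hmono : p * e * a ≤ p * e * (a + 1) := by linarith
    by_cases hr0 : r = 0
    · exact ⟨0, zero_mem _, by simp [hp.ne_zero], by simp [hr0, hp.ne_zero]⟩
    obtain ⟨k, hk⟩ := hM.2 r hr hr0
    obtain hka | hka := (le_of_mul_le_mul_left (le_eq_coe hra hk) hpe).eq_or_lt
    · subst hka
      obtain ⟨g, hg, r', hr', w, hrg, hgv, hr'v, hw, -⟩ :=
        exists_sub_pow_eq hp hres he hM hMM' hzM hz hb0 hb hzb hzv hr hk
      obtain ⟨γ, hγ, hγv, hγr⟩ := ih (a + 1) hN r' hr' hr'v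
      refine ⟨g + γ, add_mem hg hγ, ?_, ?_⟩
      · rw [add_pow_char]
        exact le_add_coe hgv.ge (coe_le_of_le hγv hmono)
      · rw [add_pow_char, show r - (g ^ p + γ ^ p) = (r' - γ ^ p) + w by
          linear_combination hrg]
        exact le_add_coe (coe_le_of_le hγr hmin) (coe_le_of_le hw (min_le_right _ _))
    · obtain ⟨γ, hγ, hγv, hγr⟩ := ih (a + 1) hN r hr (hk ▸ by
        exact_mod_cast mul_le_mul_of_nonneg_left (by omega) hpe.le)
      exact ⟨γ, hγ, coe_le_of_le hγv hmono, coe_le_of_le hγr hmin⟩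

/-- Modulo `p`-th powers, passing from `M` to an Artin–Schreier extension with break `b` raises the
value of an element by `(p - 1) * b`. In terms of differentials, `(p - 1) * (b + 1)` is the exponent
of the different. -/
theorem exists_sub_pow_eq_coe {r : L} (hr : r ∈ M) {a : ℤ} (ha : ¬ (p : ℤ) ∣ a)
    (hra : v r = ((p * e * a : ℤ) : WithTop ℤ)) :
    ∃ γ ∈ M', ((p * e * a : ℤ) : WithTop ℤ) ≤ v (γ ^ p) ∧
      v (r - γ ^ p) = ((e * (p * a + (p - 1) * b) : ℤ) : WithTop ℤ) := by
  have : Fact p.Prime := ⟨hp⟩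
  have hp2 : (2 : ℤ) ≤ p := by exact_mod_cast hp.two_le
  have hpe : 0 < p * e := by positivity
  obtain ⟨g, hg, r', hr', w, hrg, hgv, hr'v, -, hw⟩ := exists_sub_pow_eq hp hres he hM hMM' hzM hz
    hb0 hb hzb hzv hr hra
  set N := e * (p * a + (p - 1) * b) with hN
  obtain ⟨γ, hγ, hγv, hγr⟩ := exists_le_sub_pow hp hres he hM hMM' hzM hz hb0 hb hzb hzv (N + 1)
    (N + 1 - p * e * (a + 1)).toNat (a + 1)
    (by have := Int.self_le_toNat (N + 1 - p * e * (a + 1)); linarith) r' hr' hr'v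
  refine ⟨g + γ, add_mem hg hγ, ?_, ?_⟩
  · rw [add_pow_char]
    exact le_add_coe hgv.ge (coe_le_of_le hγv (by linarith))
  · rw [add_pow_char, show r - (g ^ p + γ ^ p) = w + (r' - γ ^ p) by linear_combination hrg]
    refine add_eq_coe_of_lt (hw ha) hγr (lt_min (by omega) ?_)
    rw [hN]
    nlinarith

end Approximation

end

end

/-! ### Carries in the addition of Witt vectors -/

namespace WittVector

open MvPolynomial

variable {p : ℕ} {R : Type*} [CommRing R]

theorem coeff_init (x : WittVector p R) (n k : ℕ) :
    (init n x).coeff k = if k < n then x.coeff k else 0 := by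
  simp [init, select]

variable [hp : Fact p.Prime]

/-- `[r] * x` for `p` invertible in the base ring, where the ghost map is injective. -/
theorem teichmuller_mul_eq_mk_rat {σ : Type*} (r : MvPolynomial σ ℚ)
    (x : WittVector p (MvPolynomial σ ℚ)) :
    teichmuller p r * x = mk p fun n ↦ r ^ p ^ n * x.coeff n := by
  apply (ghostMap.bijective_of_invertible p (MvPolynomial σ ℚ)).1
  rw [map_mul]
  ext1 n
  rw [Pi.mul_apply, ghostMap_apply, ghostMap_apply, ghostMap_apply, ghostComponent_teichmuller,
    ghostComponent_apply, ghostComponent_apply, aeval_wittPolynomial, aeval_wittPolynomial,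
    Finset.mul_sum]
  refine Finset.sum_congr rfl fun i hi ↦ ?_
  have h : p ^ n = p ^ i * p ^ (n - i) := by
    rw [← pow_add, Nat.add_sub_cancel' (Nat.lt_succ_iff.1 (Finset.mem_range.1 hi))]
  rw [coeff_mk, mul_pow, ← pow_mul, ← h]
  ring

theorem teichmuller_mul_eq_mk_int {σ : Type*} (r : MvPolynomial σ ℤ)
    (x : WittVector p (MvPolynomial σ ℤ)) :
    teichmuller p r * x = mk p fun n ↦ r ^ p ^ n * x.coeff n := by
  refine map_injective (MvPolynomial.map (Int.castRingHom ℚ))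
    (MvPolynomial.map_injective _ Int.cast_injective) ?_
  rw [map_mul, map_teichmuller, teichmuller_mul_eq_mk_rat]
  ext n
  simp [map_coeff]

/-- Multiplication by a Teichmüller representative scales the coefficients. -/
theorem teichmuller_mul_coeff (r : R) (x : WittVector p R) (n : ℕ) :
    (teichmuller p r * x).coeff n = r ^ p ^ n * x.coeff n := by
  obtain ⟨r, rfl⟩ := counit_surjective R r
  obtain ⟨x, rfl⟩ := map_surjective (p := p) _ (counit_surjective R) x
  rw [← map_teichmuller, ← map_mul, teichmuller_mul_eq_mk_int]
  simp [map_coeff]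

theorem init_add_iterate_verschiebung_shift (x : WittVector p R) (i : ℕ) :
    init i x + verschiebung^[i] (x.shift i) = x := by
  have h : verschiebung^[i] (x.shift i) = tail i x := by
    have h1 := eq_iterate_verschiebung (x := tail i x) (n := i) fun k hk ↦ by
      simp [tail, select, hk.not_ge]
    rw [h1]
    congr 1
    ext k
    simp [shift_coeff, tail, select]
  rw [h, init_add_tail]

theorem iterate_verschiebung_add (x y : WittVector p R) (i : ℕ) :
    verschiebung^[i] (x + y) = verschiebung^[i] x + verschiebung^[i] y := by
  induction i with
  | zero => rfl
  | succ i ih => rw [Function.iterate_succ_apply', ih, map_add, Function.iterate_succ_apply',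
      Function.iterate_succ_apply']

theorem init_add_iterate_verschiebung_coeff (x y : WittVector p R) (i m : ℕ) :
    (init i x + verschiebung^[i] y).coeff (m + i) = y.coeff m := by
  rw [coeff_add_of_disjoint, iterate_verschiebung_coeff, coeff_init, if_neg (by omega), zero_add]
  intro k
  by_cases hk : k < i
  · exact Or.inr (iterate_verschiebung_coeff_eq_zero y hk)
  · exact Or.inl (by rw [coeff_init, if_neg hk])

/-- Adding a Witt vector divisible by `V ^ i` only affects the coefficients from `i` on, where it is
the addition of shifted Witt vectors. -/
theorem add_iterate_verschiebung_coeff (x y : WittVector p R) (i m : ℕ) :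
    (x + verschiebung^[i] y).coeff (m + i) = (x.shift i + y).coeff m := by
  nth_rw 1 [← init_add_iterate_verschiebung_shift x i]
  rw [add_assoc, ← iterate_verschiebung_add, init_add_iterate_verschiebung_coeff]

theorem add_iterate_verschiebung_coeff_self (x y : WittVector p R) (i : ℕ) :
    (x + verschiebung^[i] y).coeff i = x.coeff i + y.coeff 0 := by
  have h := add_iterate_verschiebung_coeff x y i 0
  rw [zero_add] at h
  rw [h, add_coeff_zero, shift_coeff, add_zero]

theorem add_iterate_verschiebung_coeff_of_lt (x y : WittVector p R) {i k : ℕ} (hk : k < i) :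
    (x + verschiebung^[i] y).coeff k = x.coeff k := by
  nth_rw 1 [← init_add_iterate_verschiebung_shift x i]
  rw [add_assoc, ← iterate_verschiebung_add, coeff_add_of_disjoint,
    iterate_verschiebung_coeff_eq_zero _ hk, coeff_init, if_pos hk, add_zero]
  intro k
  by_cases hk : k < i
  · exact Or.inr (iterate_verschiebung_coeff_eq_zero _ hk)
  · exact Or.inl (by rw [coeff_init, if_neg hk])

/-- The carry into coefficient `i` of a sum depends on the preceding coefficients only. -/
theorem add_coeff_eq_init (x y : WittVector p R) (i : ℕ) :
    (x + y).coeff i = (init i x + init i y).coeff i + (x.coeff i + y.coeff i) := by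
  have h : x + y = init i x + init i y + verschiebung^[i] (x.shift i + y.shift i) := by
    rw [iterate_verschiebung_add]
    nth_rw 1 [← init_add_iterate_verschiebung_shift x i]
    nth_rw 1 [← init_add_iterate_verschiebung_shift y i]
    ring
  rw [h, add_iterate_verschiebung_coeff_self, add_coeff_zero, shift_coeff, shift_coeff, add_zero]

theorem init_succ_eq (x : WittVector p R) (i : ℕ) :
    init (i + 1) x = init i x + verschiebung^[i] (teichmuller p (x.coeff i)) := by
  ext k
  rcases lt_trichotomy k i with hk | rfl | hk
  · rw [add_iterate_verschiebung_coeff_of_lt _ _ hk, coeff_init, coeff_init, if_pos hk,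
      if_pos (by omega)]
  · rw [add_iterate_verschiebung_coeff_self, coeff_init, coeff_init, if_pos (by omega),
      if_neg (by omega), zero_add, teichmuller_coeff_zero]
  · obtain ⟨m, rfl⟩ := Nat.exists_eq_add_of_lt hk
    rw [show i + m + 1 = (m + 1) + i by omega, init_add_iterate_verschiebung_coeff,
      teichmuller_coeff_pos _ _ _ (by omega), coeff_init, if_neg (by omega)]

/-- The first carry of Witt vector addition is `-((a + b) ^ p - a ^ p - b ^ p) / p`. -/
theorem wittAdd_one :
    wittAdd p 1 = X (0, 1) + X (1, 1) - ∑ k ∈ Finset.Ioo 0 p,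
      X (0, 0) ^ k * X (1, 0) ^ (p - k) * ((p.choose k / p : ℕ) : MvPolynomial (Fin 2 × ℕ) ℤ) := by
  have h := wittStructureInt_prop p (X 0 + X 1 : MvPolynomial (Fin 2) ℤ) 1
  simp only [wittPolynomial_one, map_add, map_mul, map_pow, bind₁_X_right, bind₁_C_right,
    rename_X, rename_C] at h
  change C (p : ℤ) * wittAdd p 1 + wittAdd p 0 ^ p = _ at h
  rw [wittAdd_zero, add_pow_prime_eq' hp.1] at h
  have hC : (C (p : ℤ) : MvPolynomial (Fin 2 × ℕ) ℤ) = (p : MvPolynomial (Fin 2 × ℕ) ℤ) := by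
    simp
  rw [hC] at h
  have hp0 : (p : MvPolynomial (Fin 2 × ℕ) ℤ) ≠ 0 := by exact_mod_cast hp.1.ne_zero
  refine mul_left_cancel₀ hp0 ?_
  linear_combination h

theorem add_coeff_one (x y : WittVector p R) :
    (x + y).coeff 1 = x.coeff 1 + y.coeff 1 - ∑ k ∈ Finset.Ioo 0 p,
      x.coeff 0 ^ k * y.coeff 0 ^ (p - k) * ((p.choose k / p : ℕ) : R) := by
  rw [add_coeff, wittAdd_one]
  simp [peval, Function.uncurry]

section Valuation

open AddValuation

variable {L : Type*} [Field L] {v : AddValuation L (WithTop ℤ)}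

/-- Sums of Witt vectors are isobaric: if the `k`-th coefficients of the summands have value at
least `-p ^ k * w`, then so do those of the sum. Multiplication by a Teichmüller representative
reduces this to the case `w = 0` of Witt vectors over the valuation ring. -/
theorem le_add_coeff {t : L} (ht : v t = ((1 : ℤ) : WithTop ℤ)) {w : ℤ} {x y : WittVector p L}
    (hx : ∀ k, ((-(p ^ k * w) : ℤ) : WithTop ℤ) ≤ v (x.coeff k))
    (hy : ∀ k, ((-(p ^ k * w) : ℤ) : WithTop ℤ) ≤ v (y.coeff k)) (k : ℕ) :
    ((-(p ^ k * w) : ℤ) : WithTop ℤ) ≤ v ((x + y).coeff k) := by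
  let O : Subring L :=
    { carrier := {a | ((0 : ℤ) : WithTop ℤ) ≤ v a}
      mul_mem' := fun ha hb ↦ by simpa using le_mul_coe ha hb
      one_mem' := by simp [v.map_one]
      add_mem' := fun ha hb ↦ le_add_coe ha hb
      zero_mem' := by simp
      neg_mem' := fun ha ↦ by simpa [v.map_neg] using ha }
  have hlift : ∀ x : WittVector p L, (∀ k, ((-(p ^ k * w) : ℤ) : WithTop ℤ) ≤ v (x.coeff k)) →
      ∃ x' : WittVector p O, map O.subtype x' = teichmuller p (t ^ w) * x := by
    intro x hx
    refine ⟨mk p fun k ↦ ⟨(teichmuller p (t ^ w) * x).coeff k, ?_⟩, by ext k; simp [map_coeff]⟩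
    change ((0 : ℤ) : WithTop ℤ) ≤ v _
    rw [teichmuller_mul_coeff]
    refine coe_le_of_le (le_mul_coe (pow_eq_coe (zpow_eq_coe ht w) _).ge (hx k)) ?_
    push_cast
    linarith
  obtain ⟨x', hx'⟩ := hlift x hx
  obtain ⟨y', hy'⟩ := hlift y hy
  have h1 : ((0 : ℤ) : WithTop ℤ) ≤ v (((teichmuller p (t ^ w)) * (x + y)).coeff k) := by
    rw [mul_add, ← hx', ← hy', ← _root_.map_add, map_coeff]
    exact ((x' + y').coeff k).2
  rw [teichmuller_mul_coeff] at h1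
  have h2 := pow_eq_coe (zpow_eq_coe ht w) (p ^ k)
  have h3 : (x + y).coeff k = ((t ^ w) ^ p ^ k)⁻¹ * ((t ^ w) ^ p ^ k * (x + y).coeff k) := by
    rw [inv_mul_cancel_left₀ (v.ne_zero_of_eq_coe h2)]
  rw [h3]
  refine coe_le_of_le (le_mul_coe (inv_eq_coe h2).ge h1) ?_
  push_cast
  linarith

/-- The carry in the addition of Witt vectors with zeroth coefficients `D` and `a`, where `a` has
the deeper pole, is dominated by the term `D * a ^ (p - 1)`. -/
theorem carry_eq_coe {D a : L} {d α : ℤ} (hD : v D = (d : WithTop ℤ)) (ha : v a = (α : WithTop ℤ))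
    (hda : α < d) :
    v (∑ k ∈ Finset.Ioo 0 p, D ^ k * a ^ (p - k) * ((p.choose k / p : ℕ) : L)) =
      ((d + (p - 1) * α : ℤ) : WithTop ℤ) := by
  have hp1 := hp.1.one_lt
  rw [← Finset.add_sum_erase _ _ (Finset.mem_Ioo.2 ⟨one_pos, hp1⟩ : 1 ∈ Finset.Ioo 0 p)]
  have h1 : v (D ^ 1 * a ^ (p - 1) * ((p.choose 1 / p : ℕ) : L)) =
      ((d + (p - 1) * α : ℤ) : WithTop ℤ) := by
    rw [Nat.choose_one_right, Nat.div_self hp.1.pos, Nat.cast_one, mul_one,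
      mul_eq_coe (pow_eq_coe hD 1) (pow_eq_coe ha (p - 1)), Nat.cast_sub hp1.le]
    simp
  refine add_eq_coe_of_lt h1 (b := d + (p - 1) * α + 1) (v.map_le_sum fun k hk ↦ ?_) (by omega)
  rw [Finset.mem_erase, Finset.mem_Ioo] at hk
  refine coe_le_of_le (le_mul_coe (mul_eq_coe (pow_eq_coe hD k) (pow_eq_coe ha (p - k))).ge
    (zero_le_natCast _)) ?_
  rw [Nat.cast_sub hk.2.2.le]
  have : (2 : ℤ) ≤ k := by
    have := hk.1
    have := hk.2.1
    omega
  nlinarith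

/-- The effect of adding `1` to a Witt vector whose coefficients have poles of rapidly growing
order: in each coefficient the increment is dominated by the carry from the preceding one. -/
theorem add_one_coeff_sub_eq_coe [CharP L p] {t : L} (ht : v t = ((1 : ℤ) : WithTop ℤ))
    {y : WittVector p L} {c : ℕ → ℤ} {N : ℕ}
    (hy : ∀ k < N, v (y.coeff k) = ((-(p ^ k * c k) : ℤ) : WithTop ℤ))
    (hc : ∀ k < N, 0 < c k) (hgrow : ∀ k, k + 1 < N → p * c k < c (k + 1)) :
    ∀ m ≤ N, v ((y + 1).coeff m - y.coeff m) =
      ((-((p - 1) * ∑ k ∈ Finset.range m, p ^ k * c k) : ℤ) : WithTop ℤ) := by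
  have hp2 : (2 : ℤ) ≤ p := by exact_mod_cast hp.1.two_le
  have hpk : ∀ k : ℕ, (0 : ℤ) < (p : ℤ) ^ k := fun k ↦ by positivity
  have hinit : ∀ m, (y + 1).coeff m - y.coeff m = (init m y + 1).coeff m := by
    intro m
    have h : y + 1 = init m y + 1 + verschiebung^[m] (y.shift m) := by
      nth_rw 1 [← init_add_iterate_verschiebung_shift y m]
      ring
    rw [h, add_iterate_verschiebung_coeff_self, shift_coeff, add_zero, add_sub_cancel_right]
  -- the pole orders `c k` are increasing
  have hmono : ∀ m < N, ∀ k ≤ m, c k ≤ c m := by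
    intro m
    induction m with
    | zero =>
      intro _ k hk
      rw [Nat.le_zero.1 hk]
    | succ m ih =>
      intro hm k hk
      rcases hk.eq_or_lt with rfl | hk
      · rfl
      · have h1 := ih (by omega) k (by omega)
        have h2 := hgrow m hm
        have h3 := hc m (by omega)
        nlinarith
  have hsum : ∀ m < N, (p - 1) * ∑ k ∈ Finset.range m, (p : ℤ) ^ k * c k < p ^ m * c m := by
    intro m
    induction m with
    | zero =>
      intro hm
      simpa using hc 0 hm
    | succ m ih =>
      intro hm
      have h1 := ih (by omega)
      have h2 := hgrow m hm
      have h3 := mul_lt_mul_of_pos_left h2 (hpk m)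
      have h4 : (p : ℤ) ^ m * c (m + 1) ≤ p ^ (m + 1) * c (m + 1) :=
        mul_le_mul_of_nonneg_right (pow_le_pow_right₀ (by omega) (by omega)) (hc _ hm).le
      rw [Finset.sum_range_succ]
      linarith
  intro m
  simp only [hinit]
  induction m with
  | zero =>
    intro _
    have : init 0 y = 0 := by
      ext k
      simp [coeff_init]
    simp [this, v.map_one]
  | succ m ih =>
    intro hm
    have hD := ih (by omega)
    have h1 : init (m + 1) y + 1 = init m y + 1 + verschiebung^[m] (teichmuller p (y.coeff m)) := by
      rw [init_succ_eq]
      ring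
    rw [h1, show m + 1 = 1 + m by omega, add_iterate_verschiebung_coeff, add_coeff_one, shift_coeff,
      shift_coeff, teichmuller_coeff_zero, teichmuller_coeff_pos _ _ 1 one_pos, add_zero, add_zero,
      sub_eq_neg_add]
    have hcarry := carry_eq_coe (p := p) hD (hy m (by omega)) (by
      have := hsum m (by omega)
      linarith)
    have hval : -((p - 1) * ∑ k ∈ Finset.range m, (p : ℤ) ^ k * c k) + (p - 1) * -(p ^ m * c m) =
        -((p - 1) * ∑ k ∈ Finset.range (1 + m), (p : ℤ) ^ k * c k) := by
      rw [add_comm 1 m, Finset.sum_range_succ]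
      ring
    rw [hval] at hcarry
    -- the contribution of the coefficients before `m` is bounded by isobaricity
    obtain ⟨ω, hω0, hω, hωm⟩ : ∃ ω : ℤ, 0 ≤ ω ∧ (∀ k < m, c k ≤ ω) ∧ p * ω < c m := by
      rcases m with _ | m
      · exact ⟨0, le_rfl, by simp, by simpa using hc 0 (by omega)⟩
      · exact ⟨c m, (hc m (by omega)).le, fun k hk ↦ hmono m (by omega) k (by omega),
          hgrow m (by omega)⟩
    have hE : ((-(p ^ (m + 1) * ω) : ℤ) : WithTop ℤ) ≤ v ((init m y + 1).coeff (m + 1)) := by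
      refine le_add_coeff ht (fun k ↦ ?_) (fun k ↦ ?_) (m + 1)
      · rw [coeff_init]
        split_ifs with hk
        · rw [hy k (by omega)]
          have := mul_le_mul_of_nonneg_left (hω k hk) (hpk k).le
          exact_mod_cast neg_le_neg this
        · simp
      · rcases k with _ | k
        · rw [one_coeff_zero, v.map_one]
          exact_mod_cast (by simpa using hω0 : -(((p : ℤ)) ^ 0 * ω) ≤ 0)
        · rw [one_coeff_eq_of_pos _ _ _ (by omega)]
          simp
    refine add_eq_coe_of_lt (by rw [v.map_neg, hcarry]) hE ?_
    have h2 := mul_lt_mul_of_pos_left hωm (hpk m)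
    have h3 : 0 ≤ ∑ k ∈ Finset.range m, (p : ℤ) ^ k * c k :=
      Finset.sum_nonneg fun k hk ↦ mul_nonneg (hpk k).le
        (hc k (by have := Finset.mem_range.1 hk; omega)).le
    have h4 := mul_pos (hpk m) (hc m (by omega))
    rw [add_comm 1 m, Finset.sum_range_succ, pow_succ]
    nlinarith

end Valuation

end WittVector

/-! ### Towers of Artin–Schreier extensions -/

section

open AddValuation

section

variable {K L : Type*} [Field K] [Field L] [Algebra K L] {v : AddValuation L (WithTop ℤ)}

/-- One step in a tower of Artin–Schreier extensions. The equation `x ^ p - x = β + c` defines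
`M' / M`, of degree `p`, where `β` comes from the base field and `c` is a carry term. If the break
`b` of `M' / M` exceeds the contribution `U` of the lower steps, then `β` dominates, and its pole
order `m` is determined by `b`. -/
theorem HasBreak.exists_pole_order {M M' : IntermediateField K L} {e : ℤ} {p : ℕ} [CharP L p]
    (hp : p.Prime) (he : 0 < e) (hMM' : M ≤ M') (hM' : IsValueIndex v M' e) {τ : L ≃ₐ[K] L} {b : ℤ}
    (hb : HasBreak p v M' e τ b) (hfix : ∀ y ∈ M, τ y = y) {x β c : L} (hx : x ∈ M')
    (hτx : τ x = x + 1) (hxβ : x ^ p - x = β + c) {P U E : ℤ} (hP : 0 < P) (hU0 : 0 ≤ U)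
    (hU : p * e * P * U < b) (hE : E ≤ P * U)
    (hc : ((-(P * (p * (p * e * U))) : ℤ) : WithTop ℤ) ≤ v c)
    (hβ : ((0 : ℤ) : WithTop ℤ) ≤ v β ∨
      ∃ m : ℤ, v β = ((p * e * P * -m : ℤ) : WithTop ℤ) ∧ ¬ (p : ℤ) ∣ m)
    (hγ : ∀ m : ℤ, v β = ((p * e * P * -m : ℤ) : WithTop ℤ) → ¬ (p : ℤ) ∣ m →
      ∃ γ ∈ M, ((p * e * P * -m : ℤ) : WithTop ℤ) ≤ v (γ ^ p) ∧
        v (β - γ ^ p) = ((p * e * (-(P * m) + E) : ℤ) : WithTop ℤ) ∧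
        ¬ (p : ℤ) ∣ -(P * m) + E) :
    ∃ m : ℤ, p * e * U < m ∧ v β = ((p * e * P * -m : ℤ) : WithTop ℤ) ∧
      v x = ((-(e * P * m) : ℤ) : WithTop ℤ) ∧ E + b = P * m := by
  have : Fact p.Prime := ⟨hp⟩
  have hp2 : (2 : ℤ) ≤ p := by exact_mod_cast hp.two_le
  have heP : 0 < e * P := mul_pos he hP
  have hU' : 0 ≤ p * e * P * U := by positivity
  have hb0 : 0 < b := by omega
  -- elements translated by `1` have a deep pole
  have hpole : ∀ y ∈ M', τ y = y + 1 → ∀ k : ℤ, (k : WithTop ℤ) ≤ v y → k ≤ -(e * b) := by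
    intro y hy hτy k hk
    have hy0 : y ≠ 0 := by
      rintro rfl
      simp at hτy
    obtain ⟨l, hl⟩ := hM'.2 y hy hy0
    have h1 := hb.1 y hy l hl.ge
    rw [hτy, add_sub_cancel_left] at h1
    have h2 := le_eq_coe h1 (b := 0) (by rw [v.map_one]; rfl)
    have h3 := le_eq_coe hk hl
    linarith
  have hnot : ∀ y ∈ M', τ y = y + 1 →
      ¬ ((p * -(p * e * P * U) : ℤ) : WithTop ℤ) ≤ v (y ^ p - y) := by
    intro y hy hτy h
    have h1 := hpole y hy hτy _ (le_of_artinSchreier hp.one_lt (by nlinarith) h)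
    have h2 : p * e * P * U < e * b := hU.trans_le (le_mul_of_one_le_left hb0.le he)
    linarith
  have hc' : ((p * -(p * e * P * U) : ℤ) : WithTop ℤ) ≤ v c := coe_le_of_le hc (by linarith)
  have hβ' : ¬ ((p * -(p * e * P * U) : ℤ) : WithTop ℤ) ≤ v β := fun h ↦
    hnot x hx hτx (by rw [hxβ]; exact le_add_coe h hc')
  obtain h0 | ⟨m, hm, hpm⟩ := hβ
  · exact absurd (coe_le_of_le h0 (mul_nonpos_of_nonneg_of_nonpos (by omega) (by omega))) hβ'
  have hmU : p * U < m := by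
    by_contra h
    refine hβ' (coe_le_of_le hm.ge ?_)
    have := mul_le_mul_of_nonneg_left (not_lt.1 h) (mul_pos (by omega : (0 : ℤ) < p) heP).le
    linarith
  have hm0 : 0 < m := lt_of_le_of_lt (by positivity) hmU
  have hB : v (x ^ p - x) = ((p * e * P * -m : ℤ) : WithTop ℤ) := by
    rw [hxβ]
    refine add_eq_coe_of_lt hm hc' ?_
    have := mul_lt_mul_of_pos_left hmU (mul_pos (by omega : (0 : ℤ) < p) heP)
    linarith
  obtain ⟨a, ha, hxa⟩ := eq_of_artinSchreier hp.one_lt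
    (mul_neg_of_pos_of_neg (mul_pos (by positivity) hP) (by omega)) hB
  have ha' : a = -(e * P * m) := mul_left_cancel₀ (by omega : (p : ℤ) ≠ 0) (by linarith)
  subst ha'
  have hbm : b ≤ P * m := by
    have := hpole x hx hτx _ hxa.ge
    exact le_of_mul_le_mul_left (by linarith : e * b ≤ e * (P * m)) he
  have hmgrow : p * e * U < m := by
    refine lt_of_mul_lt_mul_left ?_ hP.le
    linarith
  obtain ⟨γ, hγM, hγv, hr, hpr⟩ := hγ m hm hpm
  set ρ := -(P * m) + E with hρ
  have hγv' : ((-(e * P * m) : ℤ) : WithTop ℤ) ≤ v γ :=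
    le_of_le_pow_coe hp.pos (coe_le_of_le hγv (by linarith))
  have hy : x - γ ∈ M' := sub_mem hx (hMM' hγM)
  have hτy : τ (x - γ) = x - γ + 1 := by
    rw [_root_.map_sub, hτx, hfix γ hγM]
    ring
  have hyeq : (x - γ) ^ p - (x - γ) = (β - γ ^ p) + (γ + c) := by
    rw [sub_pow_char]
    linear_combination hxβ
  -- the reduced term `β - γ ^ p` dominates both the carry and `γ`
  have hρ1 : ρ < -(p * (P * U)) := by
    by_contra h
    have h1 : P * m ≤ P * ((p + 1) * U) := by linarith
    have h2 : m ≤ p * p * U := (le_of_mul_le_mul_left h1 hP).trans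
      (mul_le_mul_of_nonneg_right (by nlinarith) hU0)
    refine hnot _ hy hτy ?_
    rw [hyeq]
    refine le_add_coe (coe_le_of_le hr.ge ?_) (le_add_coe (coe_le_of_le hγv' ?_) hc')
    · have := mul_le_mul_of_nonneg_left (not_lt.1 h) (mul_pos (by omega : (0 : ℤ) < p) he).le
      linarith
    · have := mul_le_mul_of_nonneg_left h2 heP.le
      linarith
  have hρ2 : p * ρ < -(P * m) := by
    have h1 : p * U < (p - 1) * m := by nlinarith
    have h2 := mul_lt_mul_of_pos_left h1 hP
    have h3 := mul_le_mul_of_nonneg_left hE (by omega : (0 : ℤ) ≤ p)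
    linarith
  have hρ3 := mul_lt_mul_of_pos_left hρ2 he
  have hρ4 := mul_lt_mul_of_pos_left hρ1 (mul_pos (by omega : (0 : ℤ) < p) he)
  have hyv : v ((x - γ) ^ p - (x - γ)) = ((p * e * ρ : ℤ) : WithTop ℤ) := by
    rw [hyeq]
    refine add_eq_coe_of_lt hr (b := p * e * ρ + 1) (le_add_coe (coe_le_of_le hγv' ?_)
      (coe_le_of_le hc' ?_)) (by omega) <;> linarith
  have hPm : 0 < e * (P * m) := by positivity
  obtain ⟨a, ha, hya⟩ := eq_of_artinSchreier hp.one_lt (by linarith) hyv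
  have ha' : a = e * ρ := mul_left_cancel₀ (by omega : (p : ℤ) ≠ 0) (by linarith)
  rw [ha'] at hya
  have h1 := hb.2 _ hy ρ hpr hya
  rw [hτy, add_sub_cancel_left, v.map_one] at h1
  have h2 : e * (ρ + b) = 0 := by exact_mod_cast h1.symm
  have h3 := (mul_eq_zero.1 h2).resolve_left he.ne'
  exact ⟨m, hmgrow, hm, hxa, by omega⟩

/-- The fixed field of `σ ^ p ^ i`; for a generator `σ` of a cyclic Galois group of order `p ^ n`
this is the intermediate field of degree `p ^ i`. -/
noncomputable def levelField (p : ℕ) (σ : L ≃ₐ[K] L) (i : ℕ) : IntermediateField K L :=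
  IntermediateField.fixedField (Subgroup.zpowers (σ ^ p ^ i))

theorem mem_levelField {p : ℕ} {σ : L ≃ₐ[K] L} {i : ℕ} {y : L} :
    y ∈ levelField p σ i ↔ (σ ^ p ^ i) y = y := by
  rw [levelField, IntermediateField.mem_fixedField_iff]
  constructor
  · exact fun h ↦ h _ (Subgroup.mem_zpowers _)
  · intro h f hf
    have h1 : Subgroup.zpowers (σ ^ p ^ i) ≤ MulAction.stabilizer (L ≃ₐ[K] L) y := by
      rw [Subgroup.zpowers_le]
      exact h
    exact h1 hf

theorem levelField_mono (p : ℕ) (σ : L ≃ₐ[K] L) {i j : ℕ} (hij : i ≤ j) :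
    levelField p σ i ≤ levelField p σ j := by
  refine IntermediateField.fixedField_antitone ?_
  rw [Subgroup.zpowers_le, ← Nat.add_sub_cancel' hij, pow_add, pow_mul]
  exact Subgroup.pow_mem _ (Subgroup.mem_zpowers _) _

theorem pow_apply_mem_levelField {p : ℕ} {σ : L ≃ₐ[K] L} {j : ℕ} (m : ℕ) {y : L}
    (hy : y ∈ levelField p σ j) : (σ ^ m) y ∈ levelField p σ j := by
  rw [mem_levelField] at hy ⊢
  rw [← AlgEquiv.mul_apply, ← pow_add, add_comm, pow_add, AlgEquiv.mul_apply, hy]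

/-- `σ` generates a wildly and totally ramified tower with respect to the discrete valuation `v`:
the value group of `v` on the fixed field of `σ ^ p ^ i` has index `p ^ (n - i)`. -/
structure IsWildTower (p n : ℕ) (v : AddValuation L (WithTop ℤ)) (σ : L ≃ₐ[K] L) : Prop where
  residue : HasFiniteResidue p v
  wild : IsWild v σ
  valueIndex : ∀ i ≤ n, IsValueIndex v (levelField p σ i) ((p : ℤ) ^ (n - i))
  pow_eq_one : σ ^ p ^ n = 1

theorem natCast_pow_sub_eq (p : ℕ) {n i : ℕ} (hi : i < n) :
    (p : ℤ) ^ (n - i) = p * p ^ (n - (i + 1)) := by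
  rw [← pow_succ', show n - (i + 1) + 1 = n - i by omega]

/-- The data of a tower of Artin–Schreier extensions inside a wild tower: elements `x i`
generating the successive levels. -/
structure IsArtinSchreierTower (p n : ℕ) (σ : L ≃ₐ[K] L) (x : ℕ → L) : Prop where
  mem : ∀ i < n, x i ∈ levelField p σ (i + 1)
  pow_sub_mem : ∀ i < n, x i ^ p - x i ∈ levelField p σ i
  apply_eq : ∀ i < n, (σ ^ p ^ i) (x i) = x i + 1

/-- `b i` is the ramification break of `σ ^ p ^ i`, realized by the translate `x i - γ i` of the
Artin–Schreier generator `x i`. -/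
structure IsBreakSequence (p n : ℕ) (v : AddValuation L (WithTop ℤ)) (σ : L ≃ₐ[K] L) (x : ℕ → L)
    (b : ℕ → ℤ) (γ : ℕ → L) : Prop where
  pos : ∀ i < n, 0 < b i
  not_dvd : ∀ i < n, ¬ (p : ℤ) ∣ b i
  mem : ∀ i < n, γ i ∈ levelField p σ i
  pow_sub_eq : ∀ i < n, v ((x i - γ i) ^ p - (x i - γ i)) =
    ((p * p ^ (n - (i + 1)) * -b i : ℤ) : WithTop ℤ)
  sub_eq : ∀ i < n, v (x i - γ i) = ((p ^ (n - (i + 1)) * -b i : ℤ) : WithTop ℤ)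
  hasBreak : ∀ i j, i < j → j ≤ n →
    HasBreak p v (levelField p σ j) (p ^ (n - j)) (σ ^ p ^ i) (b i)
  lt : ∀ i j, i < j → j < n → b i < b j

variable {p n : ℕ} {σ : L ≃ₐ[K] L} {x : ℕ → L} {b : ℕ → ℤ} {γ : ℕ → L}

theorem IsArtinSchreierTower.exists_breaks [CharP L p] (hp : p.Prime) (hv : IsWildTower p n v σ)
    (hx : IsArtinSchreierTower p n σ x) : ∃ b γ, IsBreakSequence p n v σ x b γ := by
  have hp0 : (0 : ℤ) < p := by exact_mod_cast hp.pos
  have hex : ∀ i : ℕ, ∃ γ : L, ∃ b : ℤ, i < n → γ ∈ levelField p σ i ∧ 0 < b ∧ ¬ (p : ℤ) ∣ b ∧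
      v ((x i - γ) ^ p - (x i - γ)) = ((p * p ^ (n - (i + 1)) * -b : ℤ) : WithTop ℤ) ∧
      v (x i - γ) = ((p ^ (n - (i + 1)) * -b : ℤ) : WithTop ℤ) := by
    intro i
    by_cases hi : i < n
    · obtain ⟨γ, hγ, b, h⟩ := IsValueIndex.exists_reduced_generator
        (natCast_pow_sub_eq p hi ▸ hv.valueIndex i hi.le) hp hv.residue (by positivity)
        (hv.wild.pow _) (fun y hy ↦ mem_levelField.1 hy) (hx.pow_sub_mem i hi) (hx.apply_eq i hi)
      exact ⟨γ, b, fun _ ↦ ⟨hγ, h⟩⟩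
    · exact ⟨0, 0, fun h ↦ absurd h hi⟩
  choose γ b h using hex
  have hfixγ : ∀ i < n, (σ ^ p ^ i) (x i - γ i) = x i - γ i + 1 := by
    intro i hi
    rw [_root_.map_sub, hx.apply_eq i hi, mem_levelField.1 (h i hi).1]
    ring
  have hzM : ∀ i < n, x i - γ i ∈ levelField p σ (i + 1) := fun i hi ↦
    sub_mem (hx.mem i hi) (levelField_mono p σ i.le_succ (h i hi).1)
  have hzpM : ∀ i < n, (x i - γ i) ^ p - (x i - γ i) ∈ levelField p σ i := by
    intro i hi
    have : Fact p.Prime := ⟨hp⟩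
    rw [sub_pow_char, show x i ^ p - γ i ^ p - (x i - γ i) =
      (x i ^ p - x i) - γ i ^ p + γ i by ring]
    exact add_mem (sub_mem (hx.pow_sub_mem i hi) (pow_mem (h i hi).1 p)) (h i hi).1
  have hdvd : ∀ i j, i < j → (σ ^ p ^ i) ^ p ^ (j - i) = σ ^ p ^ j := by
    intro i j hij
    rw [← pow_mul, ← pow_add, Nat.add_sub_cancel' hij.le]
  have hlt : ∀ i j, i < j → j < n →
      HasBreak p v (levelField p σ j) (p ^ (n - j)) (σ ^ p ^ i) (b i) → b i < b j := by
    intro i j hij hj hB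
    rw [natCast_pow_sub_eq p hj] at hB
    obtain ⟨-, -, h3, h4, -⟩ := h j hj
    exact hB.lt_of_generator hp (by positivity) (hv.wild.pow _) (hzpM j hj) h3 h4
      (dvd_pow_self p (by omega : j - i ≠ 0)) (by rw [hdvd i j hij, hfixγ j hj])
  have hB : ∀ i j, i < j → j ≤ n →
      HasBreak p v (levelField p σ j) (p ^ (n - j)) (σ ^ p ^ i) (b i) := by
    intro i j hij
    induction j, hij using Nat.le_induction with
    | base =>
      intro hi
      obtain ⟨-, -, h3, -, h5⟩ := h i hi
      refine (hv.valueIndex (i + 1) hi).hasBreak hp hv.residue (by positivity)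
        (fun y hy ↦ pow_apply_mem_levelField _ hy) (hv.wild.pow _) (hzM i hi)
        (by rwa [dvd_neg]) h5 ?_
      rw [hfixγ i hi, add_sub_cancel_left, v.map_one]
      simp
    | succ j hij ih =>
      intro hj
      obtain ⟨-, -, h3, h4, h5⟩ := h j hj
      have hBj := ih (by omega)
      have hbb := hlt i j hij hj hBj
      rw [natCast_pow_sub_eq p hj] at hBj
      exact hBj.of_generator hp hv.residue (by positivity) (hv.wild.pow _)
        (hv.valueIndex (j + 1) hj) (fun y hy ↦ pow_apply_mem_levelField _ hy) (hzM j hj)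
        (hzpM j hj) h3 h4 h5 hbb
  exact ⟨b, γ, fun i hi ↦ (h i hi).2.1, fun i hi ↦ (h i hi).2.2.1, fun i hi ↦ (h i hi).1,
    fun i hi ↦ (h i hi).2.2.2.1, fun i hi ↦ (h i hi).2.2.2.2, hB,
    fun i j hij hj ↦ hlt i j hij hj (hB i j hij hj.le)⟩

/-- The difference `p ^ i * u_i - b_i` for the `i`-th upper and lower breaks `u_i` and `b_i`,
and `0` for `i = 0`, computed recursively from the sequence `b` of lower breaks `b k = b_{k+1}`. -/
def breakDefect (p : ℕ) (b : ℕ → ℤ) : ℕ → ℤ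
  | 0 => 0
  | i + 1 => p * breakDefect p b i + (p - 1) * b i

theorem breakDefect_nonneg (hp : 1 < p) {i : ℕ} (hb : ∀ k < i, 0 < b k) :
    0 ≤ breakDefect p b i := by
  have hp' : (1 : ℤ) < p := by exact_mod_cast hp
  induction i with
  | zero => exact le_rfl
  | succ i ih =>
    have h1 := ih fun k hk ↦ hb k (by omega)
    have h2 : 0 ≤ ((p : ℤ) - 1) * b i := mul_nonneg (by omega) (hb i (by omega)).le
    rw [breakDefect]
    positivity

/-- The best approximation of an element of the base field by `p`-th powers of elements of the
`i`-th level of the tower. -/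
theorem IsBreakSequence.exists_sub_pow_eq_coe [CharP L p] (hp : p.Prime) (hv : IsWildTower p n v σ)
    (hx : IsArtinSchreierTower p n σ x) (hb : IsBreakSequence p n v σ x b γ) {a : L}
    (ha : a ∈ levelField p σ 0) {m : ℤ} (hm : ¬ (p : ℤ) ∣ m)
    (ham : v a = ((p ^ n * -m : ℤ) : WithTop ℤ)) (i : ℕ) (hi : i ≤ n) :
    ∃ g ∈ levelField p σ i, ((p ^ n * -m : ℤ) : WithTop ℤ) ≤ v (g ^ p) ∧
      v (a - g ^ p) = ((p ^ (n - i) * (-(p ^ i * m) + breakDefect p b i) : ℤ) : WithTop ℤ) ∧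
      ¬ (p : ℤ) ∣ -(p ^ i * m) + breakDefect p b i := by
  have : Fact p.Prime := ⟨hp⟩
  have hp2 : (2 : ℤ) ≤ p := by exact_mod_cast hp.two_le
  induction i with
  | zero =>
    refine ⟨0, zero_mem _, by simp [hp.ne_zero], ?_, ?_⟩
    · rw [zero_pow hp.ne_zero, sub_zero, ham]
      simp [breakDefect]
    · simpa [breakDefect] using hm
  | succ i ih =>
    obtain ⟨g, hg, hgv, hr, hpr⟩ := ih (by omega)
    have hin : i < n := hi
    have hpn : (p : ℤ) ^ n = p * p ^ (n - (i + 1)) * p ^ i := by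
      rw [← pow_succ', ← pow_add]
      congr 1
      omega
    rw [natCast_pow_sub_eq p hin] at hr
    have hzp : (x i - γ i) ^ p - (x i - γ i) ∈ levelField p σ i := by
      rw [sub_pow_char, show x i ^ p - γ i ^ p - (x i - γ i) =
        (x i ^ p - x i) - γ i ^ p + γ i by ring]
      exact add_mem (sub_mem (hx.pow_sub_mem i hin) (pow_mem (hb.mem i hin) p)) (hb.mem i hin)
    have hmono := levelField_mono p σ i.le_succ
    obtain ⟨g', hg', hgv', hr'⟩ := _root_.exists_sub_pow_eq_coe hp hv.residue (by positivity)
      (natCast_pow_sub_eq p hin ▸ hv.valueIndex i hin.le) hmono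
      (sub_mem (hx.mem i hin) (hmono (hb.mem i hin))) hzp (hb.pos i hin) (hb.not_dvd i hin)
      (hb.pow_sub_eq i hin) (hb.sub_eq i hin)
      (sub_mem (levelField_mono p σ i.zero_le ha) (pow_mem hg p)) hpr hr
    have hval : p * (-(p ^ i * m) + breakDefect p b i) + (p - 1) * b i =
        -(p ^ (i + 1) * m) + breakDefect p b (i + 1) := by
      rw [breakDefect]
      ring
    refine ⟨g + g', add_mem (hmono hg) hg', ?_, ?_, ?_⟩
    · rw [add_pow_char]
      refine le_add_coe hgv (coe_le_of_le hgv' ?_)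
      rw [hpn, mul_assoc _ _ (-m)]
      have hE := breakDefect_nonneg hp.one_lt (fun k hk ↦ hb.pos k (by omega : k < n)) (i := i)
      exact mul_le_mul_of_nonneg_left (by linarith) (by positivity)
    · rw [add_pow_char, ← sub_sub, hr', hval]
    · rw [← hval]
      intro hdvd
      have h1 := (dvd_add_right (dvd_mul_right (p : ℤ) _)).1 hdvd
      have h2 : (p : ℤ) ∣ b i := by
        have := dvd_sub (dvd_mul_right (p : ℤ) (b i)) h1
        rwa [show (p : ℤ) * b i - (p - 1) * b i = b i by ring] at this
      exact hb.not_dvd i hin h2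

/-- In a tower of Artin–Schreier extensions `x i ^ p - x i = β i + c i` with rapidly growing
breaks, where the `β i` lie in the base field and are reduced and the `c i` are isobaric carry
terms, the pole order `m i` of `β i` is the `i`-th upper break. -/
theorem IsBreakSequence.exists_pole_orders [CharP L p] (hp : p.Prime) (hv : IsWildTower p n v σ)
    (hx : IsArtinSchreierTower p n σ x) (hb : IsBreakSequence p n v σ x b γ) {β c : ℕ → L}
    (hxβ : ∀ i < n, x i ^ p - x i = β i + c i) (hβK : ∀ i < n, β i ∈ levelField p σ 0)
    (hβ : ∀ i < n, ((0 : ℤ) : WithTop ℤ) ≤ v (β i) ∨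
      ∃ m : ℤ, v (β i) = ((p ^ n * -m : ℤ) : WithTop ℤ) ∧ ¬ (p : ℤ) ∣ m)
    (hc : ∀ i < n, ∀ w : ℤ, 0 ≤ w → (∀ k < i, ((-(p ^ k * w) : ℤ) : WithTop ℤ) ≤ v (x k) ∧
      ((-(p ^ k * w) : ℤ) : WithTop ℤ) ≤ v (β k)) → ((-(p ^ i * w) : ℤ) : WithTop ℤ) ≤ v (c i))
    (hgrow : ∀ i, i + 1 < n → p ^ n * (breakDefect p b i + b i) < p ^ i * b (i + 1)) :
    ∃ m : ℕ → ℤ, ∀ i < n, 0 < m i ∧ v (x i) = ((-(p ^ (n - 1) * m i) : ℤ) : WithTop ℤ) ∧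
      breakDefect p b i + b i = p ^ i * m i ∧
      (i + 1 < n → p ^ (n - (i + 1)) * m i < m (i + 1)) := by
  have hp2 : (2 : ℤ) ≤ p := by exact_mod_cast hp.two_le
  have hstep : ∀ i < n, ∀ U : ℤ, 0 ≤ U → p ^ n * U < b i → breakDefect p b i ≤ p ^ i * U →
      (∀ k < i, ((-(p ^ k * (p * (p ^ (n - i) * U))) : ℤ) : WithTop ℤ) ≤ v (x k) ∧
        ((-(p ^ k * (p * (p ^ (n - i) * U))) : ℤ) : WithTop ℤ) ≤ v (β k)) →
      ∃ m : ℤ, p ^ (n - i) * U < m ∧ v (β i) = ((p ^ n * -m : ℤ) : WithTop ℤ) ∧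
        v (x i) = ((-(p ^ (n - 1) * m) : ℤ) : WithTop ℤ) ∧
        breakDefect p b i + b i = p ^ i * m := by
    intro i hi U hU0 hU hE hk
    have hpn : (p : ℤ) ^ n = p * p ^ (n - (i + 1)) * p ^ i := by
      rw [← pow_succ', ← pow_add]
      congr 1
      omega
    have hpn1 : (p : ℤ) ^ (n - 1) = p ^ (n - (i + 1)) * p ^ i := by
      rw [← pow_add]
      congr 1
      omega
    have hci := hc i hi _ (by positivity) hk
    have hβi := hβ i hi
    rw [natCast_pow_sub_eq p hi] at hci
    rw [natCast_pow_sub_eq p hi, hpn, hpn1]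
    rw [hpn] at hβi hU
    refine (hb.hasBreak i (i + 1) i.lt_succ_self hi).exists_pole_order hp (by positivity)
      (levelField_mono p σ i.le_succ) (hv.valueIndex (i + 1) hi) (fun y hy ↦ mem_levelField.1 hy)
      (hx.mem i hi) (hx.apply_eq i hi) (hxβ i hi) (by positivity) hU0 hU hE hci hβi ?_
    intro m hm hpm
    rw [← hpn] at hm
    obtain ⟨g, hg, h1, h2, h3⟩ := hb.exists_sub_pow_eq_coe hp hv hx (hβK i hi) hpm hm i hi.le
    rw [natCast_pow_sub_eq p hi] at h2
    rw [hpn] at h1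
    exact ⟨g, hg, h1, h2, h3⟩
  -- the data of level `i`, together with a bound for the poles at all levels up to `i`
  have hind : ∀ i < n, ∃ m : ℤ, 0 < m ∧ v (x i) = ((-(p ^ (n - 1) * m) : ℤ) : WithTop ℤ) ∧
      breakDefect p b i + b i = p ^ i * m ∧
      ∀ k < i + 1, ((-(p ^ k * (p ^ (n - i) * m)) : ℤ) : WithTop ℤ) ≤ v (x k) ∧
        ((-(p ^ k * (p ^ (n - i) * m)) : ℤ) : WithTop ℤ) ≤ v (β k) := by
    have hbound : ∀ i < n, ∀ m : ℤ, 0 < m → v (β i) = ((p ^ n * -m : ℤ) : WithTop ℤ) →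
        v (x i) = ((-(p ^ (n - 1) * m) : ℤ) : WithTop ℤ) →
        ((-(p ^ i * (p ^ (n - i) * m)) : ℤ) : WithTop ℤ) ≤ v (x i) ∧
        ((-(p ^ i * (p ^ (n - i) * m)) : ℤ) : WithTop ℤ) ≤ v (β i) := by
      intro i hi m hm0 h1 h2
      have h3 : (p : ℤ) ^ i * (p ^ (n - i) * m) = p ^ n * m := by
        rw [← mul_assoc, ← pow_add, Nat.add_sub_cancel' hi.le]
      rw [h3]
      refine ⟨coe_le_of_le h2.ge ?_, coe_le_of_le h1.ge (by linarith)⟩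
      have := mul_le_mul_of_nonneg_right
        (pow_le_pow_right₀ (by omega : (1 : ℤ) ≤ p) (Nat.sub_le n 1)) hm0.le
      linarith
    intro i
    induction i with
    | zero =>
      intro h0
      obtain ⟨m, hm0, h1, h2, h3⟩ := hstep 0 h0 0 le_rfl (by simpa using hb.pos 0 h0)
        (by simp [breakDefect]) (by simp)
      rw [mul_zero] at hm0
      refine ⟨m, hm0, h2, h3, fun k hk ↦ ?_⟩
      obtain rfl : k = 0 := by omega
      exact hbound 0 h0 m hm0 h1 h2
    | succ i ih =>
      intro hi
      obtain ⟨U, hU0, -, hU, hk⟩ := ih (by omega)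
      have hg := hgrow i hi
      have hpi : (0 : ℤ) < p ^ i := by positivity
      rw [hU, ← mul_assoc, mul_comm ((p : ℤ) ^ n), mul_assoc] at hg
      have hsub := natCast_pow_sub_eq p (Nat.lt_of_succ_lt hi)
      rw [hsub] at hk
      obtain ⟨m, hm, h1, h2, h3⟩ := hstep (i + 1) hi U hU0.le (lt_of_mul_lt_mul_left hg hpi.le) (by
        rw [breakDefect, pow_succ]
        have := hb.pos i (by omega)
        linarith [congrArg (fun t ↦ (p : ℤ) * t) hU]) (by simpa only [mul_assoc] using hk)
      have hm0 : 0 < m := lt_of_le_of_lt (by positivity) hm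
      refine ⟨m, hm0, h2, h3, fun k hk' ↦ ?_⟩
      rcases (Nat.lt_succ_iff.1 hk').eq_or_lt with rfl | hlt
      · exact hbound _ hi m hm0 h1 h2
      · have hle : p * p ^ (n - (i + 1)) * U ≤ p ^ (n - (i + 1)) * m := by
          rw [mul_comm (p : ℤ), mul_assoc]
          refine mul_le_mul_of_nonneg_left (le_trans ?_ hm.le) (by positivity)
          exact mul_le_mul_of_nonneg_right
            (le_self_pow₀ (by omega) (by omega)) hU0.le
        have := mul_le_mul_of_nonneg_left hle (by positivity : (0 : ℤ) ≤ p ^ k)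
        exact ⟨coe_le_of_le (hk k hlt).1 (by linarith), coe_le_of_le (hk k hlt).2 (by linarith)⟩
  have hex : ∀ i : ℕ, ∃ m : ℤ, i < n → 0 < m ∧
      v (x i) = ((-(p ^ (n - 1) * m) : ℤ) : WithTop ℤ) ∧ breakDefect p b i + b i = p ^ i * m ∧
      ∀ k < i + 1, ((-(p ^ k * (p ^ (n - i) * m)) : ℤ) : WithTop ℤ) ≤ v (x k) ∧
        ((-(p ^ k * (p ^ (n - i) * m)) : ℤ) : WithTop ℤ) ≤ v (β k) := by
    intro i
    by_cases hi : i < n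
    · obtain ⟨m, hm⟩ := hind i hi
      exact ⟨m, fun _ ↦ hm⟩
    · exact ⟨0, fun h ↦ absurd h hi⟩
  choose m hm using hex
  refine ⟨m, fun i hi ↦ ⟨(hm i hi).1, (hm i hi).2.1, (hm i hi).2.2.1, fun hi' ↦ ?_⟩⟩
  have hg := hgrow i hi'
  have h1 := (hm i hi).2.2.1
  have h2 := (hm (i + 1) hi').2.2.1
  have h3 := breakDefect_nonneg hp.one_lt (fun k hk ↦ hb.pos k (by omega : k < n)) (i := i + 1)
  have hpn : (p : ℤ) ^ n = p ^ (i + 1) * p ^ (n - (i + 1)) := by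
    rw [← pow_add, Nat.add_sub_cancel' (by omega)]
  rw [h1, hpn] at hg
  have h4 : (p : ℤ) ^ i * (p ^ (i + 1) * (p ^ (n - (i + 1)) * m i)) < p ^ i * b (i + 1) := by
    linarith
  have h5 := lt_of_mul_lt_mul_left h4 (by positivity)
  exact lt_of_mul_lt_mul_left (h5.trans_le (by linarith) :
    (p : ℤ) ^ (i + 1) * (p ^ (n - (i + 1)) * m i) < p ^ (i + 1) * m (i + 1)) (by positivity)

end

end

/-! ### Totally ramified extensions of local fields -/

section

open AddValuation

namespace LocalRamification

open scoped WithZero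

section Ord

variable (F : Type*) [Field F] [ValuativeRel F] [TopologicalSpace F] [IsNonarchimedeanLocalField F]

theorem ord_le_ord_iff (x y : F) :
    ord F x ≤ ord F y ↔ ValuativeRel.valuation F y ≤ ValuativeRel.valuation F x := by
  by_cases hy : y = 0
  · simp [ord, hy]
  by_cases hx : x = 0
  · simp [ord, hx, hy]
  have h : ∀ z : F, z ≠ 0 → IsNonarchimedeanLocalField.valueGroupWithZeroIsoInt F
      (ValuativeRel.valuation F z) ≠ 0 := fun z hz ↦ by simpa using hz
  rw [ord, ord, if_neg hx, if_neg hy, WithTop.coe_le_coe, neg_le_neg_iff,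
    WithZero.log_le_log (h y hy) (h x hx), OrderIsoClass.map_le_map_iff]

/-- The normalized valuation of a local field, bundled. -/
noncomputable def ordVal : AddValuation F (WithTop ℤ) :=
  AddValuation.of (ord F) (by simp [ord]) (by simp [ord])
    (fun x y ↦ by
      rw [min_le_iff, ord_le_ord_iff, ord_le_ord_iff]
      exact le_max_iff.1 ((ValuativeRel.valuation F).map_add x y))
    (fun x y ↦ by
      by_cases hx : x = 0
      · simp [ord, hx]
      by_cases hy : y = 0
      · simp [ord, hy]
      rw [ord, ord, ord, if_neg hx, if_neg hy, if_neg (mul_ne_zero hx hy), ← WithTop.coe_add,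
        _root_.map_mul, _root_.map_mul, WithZero.log_mul (by simpa using hx) (by simpa using hy),
        neg_add])

@[simp]
theorem ordVal_apply (x : F) : ordVal F x = ord F x := rfl

theorem exists_ordVal_eq_one : ∃ t : F, ordVal F t = ((1 : ℤ) : WithTop ℤ) := by
  obtain ⟨t, ht⟩ := ValuativeRel.valuation_surjective
    ((IsNonarchimedeanLocalField.valueGroupWithZeroIsoInt F).symm (WithZero.exp (-1 : ℤ)))
  have ht0 : t ≠ 0 := by
    rintro rfl
    have := congrArg (IsNonarchimedeanLocalField.valueGroupWithZeroIsoInt F) ht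
    simp only [_root_.map_zero, OrderMonoidIso.apply_symm_apply] at this
    exact WithZero.exp_ne_zero this.symm
  refine ⟨t, ?_⟩
  rw [ordVal_apply, ord, if_neg ht0, ht]
  simp

theorem zero_le_ordVal_iff (x : F) :
    ((0 : ℤ) : WithTop ℤ) ≤ ordVal F x ↔ ValuativeRel.valuation F x ≤ 1 := by
  have h := ord_le_ord_iff F 1 x
  rw [← ordVal_apply, ← ordVal_apply, AddValuation.map_one, _root_.map_one] at h
  exact h

open scoped ValuativeRel in
theorem hasFiniteResidue_ordVal (p : ℕ) [hp : Fact p.Prime] [CharP F p] :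
    HasFiniteResidue p (ordVal F) := by
  have : Fintype 𝓀[F] := Fintype.ofFinite _
  have hinj : Function.Injective (algebraMap 𝒪[F] F) := Subtype.val_injective
  have : CharP 𝒪[F] p := RingHom.charP _ hinj p
  have : CharP 𝓀[F] p := by
    rw [CharP.charP_iff_prime_eq_zero hp.1, ← _root_.map_natCast (IsLocalRing.residue 𝒪[F]),
      CharP.cast_eq_zero, _root_.map_zero]
  obtain ⟨f, -, hf⟩ := FiniteField.card 𝓀[F] p
  refine ⟨f - 1, fun y hy ↦ ?_⟩
  have hf1 : (f - 1 : ℕ) + 1 = f := Nat.sub_add_cancel f.pos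
  rw [hf1, ← hf]
  set q := Fintype.card 𝓀[F]
  let y' : 𝒪[F] := ⟨y, (zero_le_ordVal_iff F y).1 hy⟩
  by_contra hlt
  have h0 : y ^ q - y ≠ 0 := by
    intro h
    rw [h] at hlt
    simp at hlt
  obtain ⟨k, hk⟩ := (ordVal F).exists_eq_coe h0
  have hk1 : k ≤ 0 := by
    rw [hk] at hlt
    have : k < 1 := by exact_mod_cast not_le.1 hlt
    omega
  -- otherwise `y ^ q - y` would be a unit of the valuation ring
  have hinv : ((0 : ℤ) : WithTop ℤ) ≤ ordVal F (y ^ q - y)⁻¹ := by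
    rw [inv_eq_coe hk]
    exact_mod_cast neg_nonneg.2 hk1
  let z' : 𝒪[F] := ⟨(y ^ q - y)⁻¹, (zero_le_ordVal_iff F _).1 hinv⟩
  have hmul : (y' ^ q - y') * z' = 1 := Subtype.ext (mul_inv_cancel₀ h0)
  have hres := congrArg (IsLocalRing.residue 𝒪[F]) hmul
  rw [_root_.map_mul, _root_.map_sub, _root_.map_pow, FiniteField.pow_card, sub_self, zero_mul,
    _root_.map_one] at hres
  exact zero_ne_one hres

end Ord

section Extension

variable (K L : Type*) [Field K] [ValuativeRel K] [TopologicalSpace K]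
  [IsNonarchimedeanLocalField K] [Field L] [ValuativeRel L] [TopologicalSpace L]
  [IsNonarchimedeanLocalField L]
  [Algebra K L] [ValuativeExtension K L]

theorem ordVal_algebraMap_le_iff (a b : K) :
    ordVal L (algebraMap K L a) ≤ ordVal L (algebraMap K L b) ↔ ordVal K a ≤ ordVal K b := by
  rw [ordVal_apply, ordVal_apply, ordVal_apply, ordVal_apply, ord_le_ord_iff, ord_le_ord_iff,
    ← Valuation.Compatible.vle_iff_le, ← Valuation.Compatible.vle_iff_le,
    ValuativeExtension.vle_iff_vle]

/-- The least positive value of `v_L` on `K` is the ratio of `v_L` to `v_K` on `K`. -/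
theorem ramIndex_pos_and_ordVal_algebraMap : 0 < ramIndex K L ∧ ∀ (a : K) (k : ℤ),
    ordVal K a = (k : WithTop ℤ) →
    ordVal L (algebraMap K L a) = ((ramIndex K L * k : ℤ) : WithTop ℤ) := by
  obtain ⟨t, ht⟩ := exists_ordVal_eq_one K
  have ht0 := (ordVal K).ne_zero_of_eq_coe ht
  obtain ⟨e, he⟩ := (ordVal L).exists_eq_coe
    ((map_ne_zero_iff _ (algebraMap K L).injective).2 ht0)
  have hval : ∀ (a : K) (k : ℤ), ordVal K a = (k : WithTop ℤ) →
      ordVal L (algebraMap K L a) = ((e * k : ℤ) : WithTop ℤ) := by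
    intro a k ha
    have h1 : ordVal K a = ordVal K (t ^ k) := by rw [ha, zpow_eq_coe ht, mul_one]
    have h2 := le_antisymm ((ordVal_algebraMap_le_iff K L _ _).2 h1.le)
      ((ordVal_algebraMap_le_iff K L _ _).2 h1.ge)
    rw [h2, map_zpow₀, zpow_eq_coe he, mul_comm]
  have he0 : 0 < e := by
    have h : ¬ ordVal K t ≤ ordVal K 1 := by
      rw [ht, AddValuation.map_one]
      exact_mod_cast not_le.2 (zero_lt_one (α := ℤ))
    rw [← ordVal_algebraMap_le_iff K L, he, _root_.map_one, AddValuation.map_one] at h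
    exact_mod_cast not_le.1 h
  have hram : (ramIndex K L : ℤ) = e := by
    have hmem : e.toNat ∈ {e : ℕ | 0 < e ∧ ∃ a : K, ord L (algebraMap K L a) =
        ((e : ℤ) : WithTop ℤ)} :=
      ⟨by omega, t, by rw [← ordVal_apply, he, Int.toNat_of_nonneg he0.le]⟩
    obtain ⟨h1, a, ha⟩ := Nat.sInf_mem ⟨_, hmem⟩
    have h2 := Nat.sInf_le hmem
    change 0 < ramIndex K L at h1
    change ramIndex K L ≤ _ at h2
    change _ = ((ramIndex K L : ℤ) : WithTop ℤ) at ha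
    rw [← ordVal_apply] at ha
    have ha0 : a ≠ 0 := by
      rintro rfl
      simp at ha
    obtain ⟨k, hk⟩ := (ordVal K).exists_eq_coe ha0
    have h3 := coe_inj ha (hval a k hk)
    have h4 : 0 < k := pos_of_mul_pos_right (by omega : 0 < e * k) he0.le
    nlinarith [Int.toNat_of_nonneg he0.le]
  exact ⟨by omega, hram ▸ hval⟩

end Extension

end LocalRamification

section TotallyRamified

variable {K L : Type*} [Field K] [Field L] [Algebra K L] {v : AddValuation L (WithTop ℤ)} {N : ℕ}
  (hK : ∀ a : K, a ≠ 0 → ∃ k : ℤ, v (algebraMap K L a) = ((N * k : ℤ) : WithTop ℤ))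
  {t : L} (ht : v t = ((1 : ℤ) : WithTop ℤ))

include hK ht

/-- The terms of a sum of powers of a uniformizer with coefficients in `K` have distinct values. -/
theorem le_of_sum_uniformizer (c : Fin N → K) (i : Fin N) :
    v (∑ j, algebraMap K L (c j) * t ^ (j : ℕ)) ≤ v (algebraMap K L (c i) * t ^ (i : ℕ)) := by
  have hterm : ∀ j, c j ≠ 0 → ∃ k : ℤ, v (algebraMap K L (c j) * t ^ (j : ℕ)) =
      ((N * k + (j : ℕ) : ℤ) : WithTop ℤ) := by
    intro j hj
    obtain ⟨k, hk⟩ := hK _ hj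
    exact ⟨k, by rw [mul_eq_coe hk (pow_eq_coe ht _), mul_one]⟩
  obtain ⟨j, -, hj⟩ := Finset.exists_min_image Finset.univ
    (fun j ↦ v (algebraMap K L (c j) * t ^ (j : ℕ))) ⟨i, Finset.mem_univ i⟩
  refine le_trans ?_ (hj i (Finset.mem_univ i))
  by_cases hcj : c j = 0
  · simp [hcj]
  obtain ⟨k, hk⟩ := hterm j hcj
  rw [← Finset.add_sum_erase _ _ (Finset.mem_univ j)]
  refine le_of_eq ((add_eq_coe_of_lt hk (v.map_le_sum fun l hl ↦ ?_) (lt_add_one _)).trans hk.symm)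
  by_cases hcl : c l = 0
  · simp [hcl]
  obtain ⟨k', hk'⟩ := hterm l hcl
  have h1 := hj l (Finset.mem_univ l)
  rw [hk, hk'] at h1
  have h2 : (N * k + (j : ℕ) : ℤ) ≤ N * k' + (l : ℕ) := by exact_mod_cast h1
  have h3 : (j : ℕ) ≠ (l : ℕ) := fun h ↦ Finset.ne_of_mem_erase hl (Fin.ext h.symm)
  rw [hk']
  have h4 : (N * k + (j : ℕ) : ℤ) ≠ N * k' + (l : ℕ) := by
    intro h
    refine h3 ?_
    have h5 : ((j : ℕ) : ℤ) % N = ((l : ℕ) : ℤ) % N := by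
      have := congrArg (fun z : ℤ ↦ z % N) h
      simpa [Int.add_emod] using this
    rw [Int.emod_eq_of_lt (by omega) (by exact_mod_cast j.2),
      Int.emod_eq_of_lt (by omega) (by exact_mod_cast l.2)] at h5
    exact_mod_cast h5
  exact_mod_cast (by omega : (N * k + (j : ℕ) + 1 : ℤ) ≤ N * k' + (l : ℕ))

variable (hN : Module.finrank K L = N) (hN0 : 0 < N)

include hN hN0

/-- In a totally ramified extension, the powers of a uniformizer form a basis, and the terms of the
expansion of `y` have value at least that of `y`. -/
theorem exists_uniformizer_expansion (y : L) : ∃ c : Fin N → K,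
    y = ∑ j, algebraMap K L (c j) * t ^ (j : ℕ) ∧
      ∀ j, v y ≤ v (algebraMap K L (c j) * t ^ (j : ℕ)) := by
  have hli : LinearIndependent K fun j : Fin N ↦ t ^ (j : ℕ) := by
    rw [Fintype.linearIndependent_iff]
    intro c hc i
    have h := le_of_sum_uniformizer hK ht c i
    simp only [← Algebra.smul_def, hc, v.map_zero, top_le_iff, v.top_iff, smul_eq_zero] at h
    exact h.resolve_right (pow_ne_zero _ (v.ne_zero_of_eq_coe ht))
  have : Nonempty (Fin N) := ⟨⟨0, hN0⟩⟩
  let B := basisOfLinearIndependentOfCardEqFinrank hli (by simp [hN])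
  have hy : y = ∑ j, algebraMap K L (B.repr y j) * t ^ (j : ℕ) := by
    conv_lhs => rw [← B.sum_repr y]
    simp [B, Algebra.smul_def]
  refine ⟨B.repr y, hy, fun j ↦ ?_⟩
  nth_rw 1 [hy]
  exact le_of_sum_uniformizer hK ht _ j

/-- Automorphisms preserve the maximal ideal, because a uniformizer is a root of an Eisenstein
polynomial. -/
theorem one_le_apply_uniformizer (τ : L ≃ₐ[K] L) : ((1 : ℤ) : WithTop ℤ) ≤ v (τ t) := by
  have ht0 := v.ne_zero_of_eq_coe ht
  obtain ⟨a, ha⟩ := v.exists_eq_coe ((map_ne_zero_iff _ τ.injective).2 ht0)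
  obtain ⟨c, hc, hle⟩ := exists_uniformizer_expansion hK ht hN hN0 (t ^ N)
  by_contra hlt
  have ha0 : a ≤ 0 := by
    rw [ha] at hlt
    have : a < 1 := by exact_mod_cast not_le.1 hlt
    omega
  have h1 : τ t ^ N = ∑ j, algebraMap K L (c j) * τ t ^ (j : ℕ) := by
    rw [← _root_.map_pow, hc, map_sum]
    simp
  have h2 : ((N + (N - 1) * a : ℤ) : WithTop ℤ) ≤ v (τ t ^ N) := by
    rw [h1]
    refine v.map_le_sum fun j _ ↦ ?_
    by_cases hcj : c j = 0
    · simp [hcj]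
    obtain ⟨k, hk⟩ := hK _ hcj
    have h3 := hle j
    rw [pow_eq_coe ht, mul_eq_coe hk (pow_eq_coe ht _)] at h3
    have h4 : (N * 1 : ℤ) ≤ N * k + (j : ℕ) * 1 := by exact_mod_cast h3
    have hj : ((j : ℕ) : ℤ) < N := by exact_mod_cast j.2
    have hk1 : 0 < k := by
      by_contra hk0
      nlinarith
    refine coe_le_of_le (mul_eq_coe hk (pow_eq_coe ha _)).ge (add_le_add ?_ ?_)
    · exact le_mul_of_one_le_right (by omega) hk1
    · exact mul_le_mul_of_nonpos_right (by omega) ha0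
  have h3 := le_eq_coe h2 (pow_eq_coe ha N)
  have h4 : (0 : ℤ) < N := by exact_mod_cast hN0
  linarith

theorem le_apply_of_le (τ : L ≃ₐ[K] L) {y : L} {k : ℤ} (hy : (k : WithTop ℤ) ≤ v y) :
    (k : WithTop ℤ) ≤ v (τ y) := by
  obtain ⟨c, hc, hle⟩ := exists_uniformizer_expansion hK ht hN hN0 y
  have hτt := one_le_apply_uniformizer hK ht hN hN0 τ
  rw [hc, map_sum]
  refine v.map_le_sum fun j _ ↦ ?_
  by_cases hcj : c j = 0
  · simp [hcj]
  obtain ⟨l, hl⟩ := hK _ hcj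
  have h1 := le_eq_coe (hy.trans (hle j)) (mul_eq_coe hl (pow_eq_coe ht _))
  rw [_root_.map_mul, _root_.map_pow, AlgEquiv.commutes]
  exact coe_le_of_le (le_mul_coe hl.ge (le_pow_coe hτt _)) h1

theorem apply_eq_coe (τ : L ≃ₐ[K] L) {y : L} {k : ℤ} (hy : v y = (k : WithTop ℤ)) :
    v (τ y) = (k : WithTop ℤ) := by
  have h0 := (map_ne_zero_iff _ τ.injective).2 (v.ne_zero_of_eq_coe hy)
  obtain ⟨l, hl⟩ := v.exists_eq_coe h0
  have h1 := le_eq_coe (le_apply_of_le hK ht hN hN0 τ hy.ge) hl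
  have h2 := le_apply_of_le hK ht hN hN0 τ.symm hl.ge
  rw [AlgEquiv.symm_apply_apply] at h2
  rw [hl, le_antisymm (le_eq_coe h2 hy) h1]

/-- The residue field does not grow in a totally ramified extension, so automorphisms act trivially
on it. -/
theorem one_le_apply_sub (τ : L ≃ₐ[K] L) {y : L} (hy : ((0 : ℤ) : WithTop ℤ) ≤ v y) :
    ((1 : ℤ) : WithTop ℤ) ≤ v (τ y - y) := by
  obtain ⟨c, hc, hle⟩ := exists_uniformizer_expansion hK ht hN hN0 y
  have h0 : τ y - y = ∑ j, (τ (algebraMap K L (c j) * t ^ (j : ℕ)) -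
      algebraMap K L (c j) * t ^ (j : ℕ)) := by
    rw [Finset.sum_sub_distrib, ← map_sum, ← hc]
  rw [h0]
  refine v.map_le_sum fun j _ ↦ ?_
  by_cases hj0 : (j : ℕ) = 0
  · simp [hj0]
  have hj : ((1 : ℤ) : WithTop ℤ) ≤ v (algebraMap K L (c j) * t ^ (j : ℕ)) := by
    by_cases hcj : c j = 0
    · simp [hcj]
    obtain ⟨l, hl⟩ := hK _ hcj
    have h1 := mul_eq_coe hl (pow_eq_coe ht (j : ℕ))
    have h2 := le_eq_coe (hy.trans (hle j)) h1
    have h3 : 0 ≤ l := by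
      by_contra hl0
      have : ((j : ℕ) : ℤ) < N := by exact_mod_cast j.2
      nlinarith
    refine coe_le_of_le h1.ge ?_
    have : 0 ≤ (N : ℤ) * l := by positivity
    omega
  exact le_sub_coe (le_apply_of_le hK ht hN hN0 τ hj) hj

/-- In characteristic `p`, automorphisms of `p`-power order are wildly ramified: the residue
`u` of `τ t / t` satisfies `u ^ p ^ n = 1`, hence `u = 1`. -/
theorem isWild_of_pow_eq_one {p : ℕ} [hp : Fact p.Prime] [CharP L p] {τ : L ≃ₐ[K] L} {n : ℕ}
    (hτ : τ ^ p ^ n = 1) : IsWild v τ := by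
  have ht0 := v.ne_zero_of_eq_coe ht
  have hτt := apply_eq_coe hK ht hN hN0 τ ht
  set u := τ t * t⁻¹ with hu
  have huv : v u = ((0 : ℤ) : WithTop ℤ) := by
    rw [hu, mul_eq_coe hτt (inv_eq_coe ht), add_neg_cancel]
  have hut : τ t = u * t := by rw [hu, inv_mul_cancel_right₀ ht0]
  have hpow : ∀ m : ℕ, ((1 : ℤ) : WithTop ℤ) ≤ v ((τ ^ m) t * t⁻¹ - u ^ m) := by
    intro m
    induction m with
    | zero => simp [ht0]
    | succ m ih =>
      have h1 : (τ ^ (m + 1)) t * t⁻¹ - u ^ (m + 1) =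
          ((τ ^ m) u - u) * ((τ ^ m) t * t⁻¹) + u * ((τ ^ m) t * t⁻¹ - u ^ m) := by
        rw [pow_succ τ m, AlgEquiv.mul_apply, hut, _root_.map_mul]
        ring
      rw [h1]
      have h2 := mul_eq_coe (apply_eq_coe hK ht hN hN0 (τ ^ m) ht) (inv_eq_coe ht)
      exact le_add_coe (le_mul_coe (one_le_apply_sub hK ht hN hN0 (τ ^ m) huv.ge) h2.ge)
        (le_mul_coe huv.ge ih)
  have hu1 : ((1 : ℤ) : WithTop ℤ) ≤ v (1 - u) := by
    have h1 := hpow (p ^ n)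
    rw [hτ, AlgEquiv.one_apply, mul_inv_cancel₀ ht0] at h1
    have h2 : (1 - u) ^ p ^ n = 1 - u ^ p ^ n := by rw [sub_pow_char_pow, one_pow]
    rw [← h2] at h1
    by_cases h0 : 1 - u = 0
    · simp [h0]
    obtain ⟨k, hk⟩ := v.exists_eq_coe h0
    have h3 := le_eq_coe h1 (pow_eq_coe hk _)
    have h4 : 0 < k := pos_of_mul_pos_right (by omega) (by positivity : (0 : ℤ) ≤ (p ^ n : ℕ))
    rw [hk]
    exact_mod_cast h4
  have htj : ∀ j : ℕ, ((j + 1 : ℤ) : WithTop ℤ) ≤ v (τ t ^ j - t ^ j) := by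
    intro j
    induction j with
    | zero => simp
    | succ j ih =>
      have h1 : τ t ^ (j + 1) - t ^ (j + 1) =
          (τ t ^ j - t ^ j) * τ t + -(t ^ (j + 1) * (1 - u)) := by
        rw [hut]
        ring
      rw [h1]
      refine le_add_coe (coe_le_of_le (le_mul_coe ih hτt.ge) ?_) ?_
      · push_cast
        linarith
      · rw [v.map_neg]
        refine coe_le_of_le (le_mul_coe (pow_eq_coe ht _).ge hu1) ?_
        push_cast
        linarith
  intro y k hy
  obtain ⟨c, hc, hle⟩ := exists_uniformizer_expansion hK ht hN hN0 y
  have h0 : τ y - y = ∑ j, (algebraMap K L (c j) * (τ t ^ (j : ℕ) - t ^ (j : ℕ))) := by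
    nth_rw 2 [hc]
    nth_rw 1 [hc]
    rw [map_sum, ← Finset.sum_sub_distrib]
    simp [mul_sub]
  rw [h0]
  refine v.map_le_sum fun j _ ↦ ?_
  by_cases hcj : c j = 0
  · simp [hcj]
  obtain ⟨l, hl⟩ := hK _ hcj
  have h1 := le_eq_coe (hy.trans (hle j)) (mul_eq_coe hl (pow_eq_coe ht _))
  refine coe_le_of_le (le_mul_coe hl.ge (htj j)) ?_
  omega

end TotallyRamified

section Galois

variable {K L : Type*} [Field K] [Field L] [Algebra K L]

theorem levelField_zero [FiniteDimensional K L] [IsGalois K L] {p : ℕ} {σ : L ≃ₐ[K] L}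
    (hσ : ∀ τ : L ≃ₐ[K] L, τ ∈ Subgroup.zpowers σ) {y : L} :
    y ∈ levelField p σ 0 ↔ y ∈ Set.range (algebraMap K L) := by
  rw [IsGalois.mem_range_algebraMap_iff_fixed, levelField, pow_zero, pow_one,
    IntermediateField.mem_fixedField_iff]
  exact ⟨fun h τ ↦ h τ (hσ τ), fun h τ _ ↦ h τ⟩

/-- The norm of `y` from the fixed field of `τ ^ m` to that of `τ`. -/
theorem apply_prod_pow_apply {τ : L ≃ₐ[K] L} {m : ℕ} {y : L} (hy : (τ ^ m) y = y) :
    τ (∏ k ∈ Finset.range m, (τ ^ k) y) = ∏ k ∈ Finset.range m, (τ ^ k) y := by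
  have h1 : τ (∏ k ∈ Finset.range m, (τ ^ k) y) = ∏ k ∈ Finset.range m, (τ ^ (k + 1)) y := by
    rw [map_prod]
    refine Finset.prod_congr rfl fun k _ ↦ ?_
    rw [pow_succ', AlgEquiv.mul_apply]
  rcases m with _ | m
  · simp
  rw [h1, Finset.prod_range_succ, hy, Finset.prod_range_succ', pow_zero, AlgEquiv.one_apply]

theorem prod_pow_apply_eq_coe {v : AddValuation L (WithTop ℤ)} {τ : L ≃ₐ[K] L} (hτ : IsWild v τ)
    {y : L} {k : ℤ} (hy : v y = (k : WithTop ℤ)) (m : ℕ) :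
    v (∏ j ∈ Finset.range m, (τ ^ j) y) = ((m * k : ℤ) : WithTop ℤ) := by
  induction m with
  | zero => simp [v.map_one]
  | succ m ih =>
    rw [Finset.prod_range_succ, mul_eq_coe ih (((hτ.pow m).map_eq y).trans hy)]
    congr 1
    push_cast
    ring

/-- The value groups of the levels of a cyclic totally ramified extension of degree `p ^ n`,
computed by means of norms from `L` and to `K`. -/
theorem isValueIndex_levelField [FiniteDimensional K L] [IsGalois K L] {p n : ℕ} (hp : 0 < p)
    {σ : L ≃ₐ[K] L} (hσ : ∀ τ : L ≃ₐ[K] L, τ ∈ Subgroup.zpowers σ) (hσn : σ ^ p ^ n = 1)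
    {v : AddValuation L (WithTop ℤ)} (hw : IsWild v σ)
    (hK : ∀ a : K, a ≠ 0 → ∃ k : ℤ, v (algebraMap K L a) = ((p ^ n * k : ℤ) : WithTop ℤ))
    {t : L} (ht : v t = ((1 : ℤ) : WithTop ℤ)) {i : ℕ} (hi : i ≤ n) :
    IsValueIndex v (levelField p σ i) ((p : ℤ) ^ (n - i)) := by
  constructor
  · refine ⟨∏ j ∈ Finset.range (p ^ (n - i)), ((σ ^ p ^ i) ^ j) t, ?_, ?_⟩
    · rw [mem_levelField]
      refine apply_prod_pow_apply ?_
      rw [← pow_mul, ← pow_add, Nat.add_sub_cancel' hi, hσn, AlgEquiv.one_apply]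
    · rw [prod_pow_apply_eq_coe (hw.pow _) ht]
      simp
  · intro y hy hy0
    obtain ⟨k, hk⟩ := v.exists_eq_coe hy0
    have h1 := prod_pow_apply_eq_coe hw hk (p ^ i)
    obtain ⟨a, ha⟩ : (∏ j ∈ Finset.range (p ^ i), (σ ^ j) y) ∈ Set.range (algebraMap K L) := by
      rw [← levelField_zero (p := p) hσ, mem_levelField, pow_zero, pow_one]
      exact apply_prod_pow_apply (mem_levelField.1 hy)
    rw [← ha] at h1
    obtain ⟨l, hl⟩ := hK a fun ha0 ↦ v.ne_zero_of_eq_coe h1 (by rw [ha0, _root_.map_zero])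
    have h2 := coe_inj h1 hl
    have h3 : (p : ℤ) ^ n = p ^ i * p ^ (n - i) := by rw [← pow_add, Nat.add_sub_cancel' hi]
    refine ⟨l, ?_⟩
    rw [hk]
    congr 1
    have hpi : (p : ℤ) ^ i ≠ 0 := by positivity
    refine mul_left_cancel₀ hpi ?_
    push_cast at h2
    rw [h2, h3, mul_assoc]

end Galois

namespace LocalRamification

variable {K L : Type*} [Field K] [ValuativeRel K] [TopologicalSpace K]
  [IsNonarchimedeanLocalField K] [Field L] [ValuativeRel L] [TopologicalSpace L]
  [IsNonarchimedeanLocalField L]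
  [Algebra K L] [ValuativeExtension K L]

theorem IsTotallyRamified.ordVal_algebraMap (hram : IsTotallyRamified K L) {p n : ℕ}
    (hdeg : Module.finrank K L = p ^ n) {a : K} {k : ℤ} (ha : ordVal K a = (k : WithTop ℤ)) :
    ordVal L (algebraMap K L a) = ((p ^ n * k : ℤ) : WithTop ℤ) := by
  have h := (ramIndex_pos_and_ordVal_algebraMap K L).2 a k ha
  rw [hram, hdeg] at h
  rw [h]
  push_cast
  rfl

/-- A totally ramified cyclic extension of degree `p ^ n` of a local field of characteristic `p` is
a wild tower. -/
theorem IsTotallyRamified.isWildTower [FiniteDimensional K L] [IsGalois K L] {p n : ℕ}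
    [hp : Fact p.Prime] [CharP L p]
    (hram : IsTotallyRamified K L) (hdeg : Module.finrank K L = p ^ n) {σ : L ≃ₐ[K] L}
    (hσ : ∀ τ : L ≃ₐ[K] L, τ ∈ Subgroup.zpowers σ) : IsWildTower p n (ordVal L) σ := by
  obtain ⟨t, ht⟩ := exists_ordVal_eq_one L
  have hK : ∀ a : K, a ≠ 0 →
      ∃ k : ℤ, ordVal L (algebraMap K L a) = ((p ^ n * k : ℤ) : WithTop ℤ) := by
    intro a ha
    obtain ⟨k, hk⟩ := (ordVal K).exists_eq_coe ha
    exact ⟨k, hram.ordVal_algebraMap hdeg hk⟩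
  have hσn : σ ^ p ^ n = 1 := by
    rw [← hdeg, ← IsGalois.card_aut_eq_finrank]
    exact pow_card_eq_one'
  have hw : IsWild (ordVal L) σ := isWild_of_pow_eq_one (N := p ^ n) (by exact_mod_cast hK) ht hdeg
    (pow_pos hp.1.pos n) hσn
  exact ⟨hasFiniteResidue_ordVal L p, hw,
    fun i hi ↦ isValueIndex_levelField hp.1.pos hσ hσn hw hK ht hi, hσn⟩

end LocalRamification

end

/-! ### Lower and upper ramification breaks -/

section

open AddValuation

namespace LocalRamification

variable {K L : Type*} [Field K] [Field L] [ValuativeRel L] [TopologicalSpace L]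
  [IsNonarchimedeanLocalField L] [Algebra K L] {p n : ℕ} {σ : L ≃ₐ[K] L}

theorem mem_lowerGroup_iff {τ : L ≃ₐ[K] L} {m : ℕ} :
    τ ∈ lowerGroup K L m ↔ ∀ a : L, ((0 : ℤ) : WithTop ℤ) ≤ ordVal L a →
      ((m + 1 : ℤ) : WithTop ℤ) ≤ ordVal L (τ a - a) := Iff.rfl

/-- The ramification break characterizes membership in the lower ramification groups. -/
theorem mem_lowerGroup_iff_le_break [hp : Fact p.Prime] [CharP L p] {M : IntermediateField K L}
    (hM : ∀ y, y ∈ M) (hres : HasFiniteResidue p (ordVal L)) {τ : L ≃ₐ[K] L} {b : ℤ}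
    (hb : HasBreak p (ordVal L) M 1 τ b) (hb0 : 0 < b) {m : ℕ} :
    τ ∈ lowerGroup K L m ↔ (m : ℤ) ≤ b := by
  rw [mem_lowerGroup_iff]
  constructor
  · intro h
    obtain ⟨t, ht⟩ := exists_ordVal_eq_one L
    have h1 := hb.2 t (hM t) 1 (fun h ↦ hp.1.one_lt.ne' (Nat.dvd_one.1 (by exact_mod_cast h)))
      (by rw [ht, mul_one])
    have h2 := le_eq_coe (h t (by rw [ht]; exact_mod_cast zero_le_one)) h1
    omega
  · intro hm a ha
    obtain ⟨f, hf⟩ := hres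
    set q := p ^ (f + 1) with hq
    have h1 : τ a - a = (τ (a - a ^ q) - (a - a ^ q)) + (τ a - a) ^ q := by
      rw [hq, sub_pow_char_pow, _root_.map_sub, _root_.map_pow]
      ring
    have h2 : ((1 : ℤ) : WithTop ℤ) ≤ ordVal L (a - a ^ q) := by
      rw [← neg_sub, AddValuation.map_neg]
      exact hf a ha
    rw [h1]
    refine le_add_coe (coe_le_of_le (hb.1 _ (hM _) 1 (by rwa [mul_one])) (by omega))
      (coe_le_of_le (le_pow_coe (hb.1 a (hM a) 0 (by rwa [mul_zero])) q) ?_)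
    have hq2 : (2 : ℤ) ≤ q := by
      have h3 : p ≤ q := Nat.le_self_pow (Nat.succ_ne_zero f) p
      exact_mod_cast hp.1.two_le.trans h3
    nlinarith

theorem isWild_of_mem_zpowers [FiniteDimensional K L] (hw : IsWild (ordVal L) σ)
    {τ : L ≃ₐ[K] L} (hτ : τ ∈ Subgroup.zpowers σ) : IsWild (ordVal L) τ := by
  obtain ⟨m, rfl⟩ := (mem_powers_iff_mem_zpowers.2 hτ)
  exact hw.pow m

/-- The lower ramification group, as a subgroup. -/
noncomputable def lowerSubgroup (h : ∀ τ : L ≃ₐ[K] L, IsWild (ordVal L) τ) (m : ℕ) :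
    Subgroup (L ≃ₐ[K] L) where
  carrier := lowerGroup K L m
  one_mem' := by
    rw [mem_lowerGroup_iff]
    simp
  mul_mem' {s t} hs ht := by
    rw [mem_lowerGroup_iff] at hs ht ⊢
    intro a ha
    rw [AlgEquiv.mul_apply, ← sub_add_sub_cancel _ (t a) a]
    exact le_add_coe (hs (t a) (by rwa [(h t).map_eq])) (ht a ha)
  inv_mem' {s} hs := by
    rw [mem_lowerGroup_iff] at hs ⊢
    intro a ha
    have h1 : s (s⁻¹ a) = a := by rw [← AlgEquiv.mul_apply, mul_inv_cancel, AlgEquiv.one_apply]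
    have h2 := hs (s⁻¹ a) (by rwa [(h _).map_eq])
    rw [h1] at h2
    rwa [← neg_sub, AddValuation.map_neg]

section Breaks

variable [hp : Fact p.Prime] [CharP L p] [FiniteDimensional K L]
  (hσ : ∀ τ : L ≃ₐ[K] L, τ ∈ Subgroup.zpowers σ) (hord : orderOf σ = p ^ n)
  (hv : IsWildTower p n (ordVal L) σ) {x : ℕ → L} {b : ℕ → ℤ} {γ : ℕ → L}
  (hb : IsBreakSequence p n (ordVal L) σ x b γ)

include hσ hord hv hb

/-- Between two consecutive breaks, the lower ramification group has constant order. -/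
theorem card_lowerGroup {m k : ℕ} (hk : k ≤ n) (hlt : ∀ i < k, b i < m)
    (hle : k < n → (m : ℤ) ≤ b k) : Nat.card (lowerGroup K L m) = p ^ (n - k) := by
  have hw := fun τ ↦ isWild_of_mem_zpowers hv.wild (hσ τ)
  have hmem : ∀ i < n, σ ^ p ^ i ∈ lowerGroup K L m ↔ (m : ℤ) ≤ b i := by
    intro i hi
    have h1 := hb.hasBreak i n hi le_rfl
    rw [Nat.sub_self, pow_zero] at h1
    refine mem_lowerGroup_iff_le_break (fun y ↦ ?_) hv.residue h1 (hb.pos i hi)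
    rw [mem_levelField, hv.pow_eq_one, AlgEquiv.one_apply]
  have heq : lowerSubgroup hw m = Subgroup.zpowers (σ ^ p ^ k) := by
    apply le_antisymm
    · intro τ hτ
      obtain ⟨j, rfl⟩ := mem_powers_iff_mem_zpowers.2 (hσ τ)
      change σ ^ j ∈ _ at hτ
      change σ ^ j ∈ _
      rcases Nat.eq_zero_or_pos j with rfl | hj
      · rw [pow_zero]
        exact one_mem _
      obtain ⟨s, l, hl, rfl⟩ := Nat.exists_eq_pow_mul_and_not_dvd hj.ne' p hp.1.ne_one
      rw [pow_mul] at hτ ⊢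
      by_cases hsk : k ≤ s
      · rw [← Nat.add_sub_cancel' hsk, pow_add, pow_mul]
        exact Subgroup.pow_mem _ (Subgroup.pow_mem _ (Subgroup.mem_zpowers _) _) _
      · -- `σ ^ p ^ s` would be a power of an element of the ramification group
        have hcop : Nat.Coprime l (orderOf (σ ^ p ^ s)) := by
          rw [orderOf_pow_of_dvd (pow_ne_zero _ hp.1.ne_zero) (hord ▸ pow_dvd_pow p (by omega)),
            hord, Nat.pow_div (by omega) hp.1.pos]
          exact Nat.Coprime.pow_right _ ((Nat.Prime.coprime_iff_not_dvd hp.1).2 hl).symm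
        obtain ⟨r, hr⟩ := exists_pow_eq_self_of_coprime hcop
        have h1 : σ ^ p ^ s ∈ lowerSubgroup hw m := hr ▸ Subgroup.pow_mem _ hτ r
        have h2 := (hmem s (by omega)).1 h1
        have := hlt s (by omega)
        omega
    · rw [Subgroup.zpowers_le]
      rcases hk.eq_or_lt with rfl | hkn
      · rw [hv.pow_eq_one]
        exact one_mem _
      · exact (hmem k hkn).2 (hle hkn)
  have h1 : Nat.card (lowerGroup K L m) = Nat.card (lowerSubgroup hw m) := rfl
  rw [h1, heq, Nat.card_zpowers, orderOf_pow_of_dvd (pow_ne_zero _ hp.1.ne_zero)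
    (hord ▸ pow_dvd_pow p hk), hord, Nat.pow_div hk hp.1.pos]

/-- The `(i + 1)`-st lower break is the break of `σ ^ p ^ i`. -/
theorem lowerBreak_eq {i : ℕ} (hi : i < n) : (lowerBreak K L p n (i + 1) : ℤ) = b i := by
  have hset : {m : ℕ | p ^ (n - (i + 1)) < Nat.card (lowerGroup K L m)} =
      Set.Iic (b i).toNat := by
    ext m
    rw [Set.mem_ofPred_eq, Set.mem_Iic]
    obtain ⟨k, hk, hlt, hle⟩ : ∃ k ≤ n, (∀ i < k, b i < m) ∧ (k < n → (m : ℤ) ≤ b k) := by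
      by_cases h : ∃ k, k < n ∧ (m : ℤ) ≤ b k
      · classical
        refine ⟨Nat.find h, (Nat.find_spec h).1.le, fun i hi ↦ ?_, fun _ ↦ (Nat.find_spec h).2⟩
        by_contra hc
        exact Nat.find_min h hi ⟨hi.trans (Nat.find_spec h).1, by omega⟩
      · refine ⟨n, le_rfl, fun i hi ↦ ?_, fun h ↦ absurd h (lt_irrefl n)⟩
        by_contra hc
        exact h ⟨i, hi, by omega⟩
    rw [card_lowerGroup hσ hord hv hb hk hlt hle, Nat.pow_lt_pow_iff_right hp.1.one_lt]
    have hbi := hb.pos i hi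
    constructor
    · intro h
      have hki : k ≤ i := by omega
      have h1 := hle (by omega)
      rcases hki.eq_or_lt with rfl | hki
      · omega
      · have := hb.lt k i hki hi
        omega
    · intro h
      have : ¬ i < k := fun hik ↦ by
        have := hlt i hik
        omega
      omega
  rw [lowerBreak, hset, csSup_Iic, Int.toNat_of_nonneg (hb.pos i hi).le]

/-- The Herbrand function at the lower breaks, from the orders of the ramification groups. -/
theorem upperBreak_eq {i : ℕ} (hi : i < n) :
    (p : ℚ) ^ i * upperBreak K L p n (i + 1) = ((breakDefect p b i + b i : ℤ) : ℚ) := by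
  have hp0 : (p : ℚ) ≠ 0 := by exact_mod_cast hp.1.ne_zero
  have h0 : Nat.card (lowerGroup K L 0) = p ^ n := by
    have := card_lowerGroup hσ hord hv hb (m := 0) (k := 0) n.zero_le (by simp)
      (fun h ↦ (hb.pos 0 h).le)
    rwa [Nat.sub_zero] at this
  have hcard : ∀ i < n, ∀ m : ℕ, (∀ k < i, b k < m) → (m : ℤ) ≤ b i →
      (Nat.card (lowerGroup K L m) : ℚ) * p ^ i = p ^ n := by
    intro i hi m h1 h2
    rw [card_lowerGroup hσ hord hv hb hi.le h1 (fun _ ↦ h2)]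
    push_cast
    rw [← pow_add, Nat.sub_add_cancel hi.le]
  have hsum : ∀ i < n, (∑ k ∈ Finset.Ioc 0 (lowerBreak K L p n (i + 1)),
      (Nat.card (lowerGroup K L k) : ℚ)) * p ^ i = p ^ n * ((breakDefect p b i + b i : ℤ) : ℚ) := by
    intro i
    induction i with
    | zero =>
      intro hi
      have hB := lowerBreak_eq hσ hord hv hb hi
      rw [Finset.sum_mul, Finset.sum_congr rfl fun m hm ↦ hcard 0 hi m (by simp) (by
        rw [← hB]
        exact_mod_cast (Finset.mem_Ioc.1 hm).2)]
      rw [Finset.sum_const, Nat.card_Ioc, Nat.sub_zero, nsmul_eq_mul, breakDefect, ← hB]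
      push_cast
      ring
    | succ i ih =>
      intro hi
      have hB := lowerBreak_eq hσ hord hv hb hi
      have hB' := lowerBreak_eq hσ hord hv hb (Nat.lt_of_succ_lt hi)
      have hbb := hb.lt i (i + 1) i.lt_succ_self hi
      rw [← Finset.sum_Ioc_consecutive _ (Nat.zero_le (lowerBreak K L p n (i + 1)))
        (by omega : _ ≤ lowerBreak K L p n (i + 1 + 1)), add_mul, pow_succ, ← mul_assoc,
        ih (Nat.lt_of_succ_lt hi), ← pow_succ, Finset.sum_mul,
        Finset.sum_congr rfl fun m hm ↦ hcard (i + 1) hi m (fun k hk ↦ ?_) (by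
          rw [← hB]
          exact_mod_cast (Finset.mem_Ioc.1 hm).2),
        Finset.sum_const, Nat.card_Ioc, nsmul_eq_mul, breakDefect, Nat.cast_sub (by omega)]
      · rw [← hB, ← hB']
        push_cast
        ring
      · have h1 := (Finset.mem_Ioc.1 hm).1
        rcases (Nat.lt_succ_iff.1 hk).eq_or_lt with rfl | hk
        · omega
        · have := hb.lt k i hk (by omega)
          omega
  have hIcc : ∀ m : ℕ, Finset.Icc 1 m = Finset.Ioc 0 m := fun m ↦ by
    ext k
    simp [Nat.lt_iff_add_one_le]
  rw [upperBreak, herbrand, hIcc, h0, mul_div_assoc', mul_comm, hsum i hi]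
  push_cast
  rw [mul_div_cancel_left₀ _ (pow_ne_zero n hp0)]

end Breaks

end LocalRamification

end

/-! ### Witt vectors and cyclic extensions -/

namespace WittVector

variable {p : ℕ} [hp : Fact p.Prime] {L : Type*} [Field L] {n : ℕ}

theorem truncate_eq_iff {x y : WittVector p L} :
    truncate n x = truncate n y ↔ ∀ i < n, x.coeff i = y.coeff i := by
  constructor
  · intro h i hi
    have := congrArg (TruncatedWittVector.coeff ⟨i, hi⟩) h
    simpa using this
  · intro h
    ext i
    simpa using h i i.2

/-- Iterating an automorphism that translates a truncated Witt vector by `1`. -/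
theorem pow_apply_coeff {K : Type*} [Field K] [Algebra K L] {σ : L ≃ₐ[K] L} {x : WittVector p L}
    (h : ∀ i < n, σ (x.coeff i) = (x + 1).coeff i) (m : ℕ) :
    ∀ i < n, (σ ^ m) (x.coeff i) = (x + (m : WittVector p L)).coeff i := by
  have h1 : truncate n (map (σ : L →+* L) x) = truncate n (x + 1) := truncate_eq_iff.2 h
  induction m with
  | zero => simp
  | succ m ih =>
    intro i hi
    rw [pow_succ', AlgEquiv.mul_apply, ih i hi]
    have h2 : truncate n (map (σ : L →+* L) (x + (m : WittVector p L))) =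
        truncate n (x + ((m + 1 : ℕ) : WittVector p L)) := by
      rw [map_add, map_natCast, map_add, h1, ← map_add]
      congr 1
      push_cast
      ring
    exact truncate_eq_iff.1 h2 i hi

variable [CharP L p]

/-- In characteristic `p`, the Witt vector `p ^ i` is `V ^ i 1`. -/
theorem natCast_pow_eq_iterate_verschiebung (i : ℕ) :
    ((p ^ i : ℕ) : WittVector p L) = verschiebung^[i] 1 := by
  ext k
  rw [Nat.cast_pow]
  by_cases hk : k < i
  · rw [coeff_p_pow_eq_zero p L hk.ne, iterate_verschiebung_coeff_eq_zero _ hk]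
  · obtain ⟨m, rfl⟩ := Nat.exists_eq_add_of_le (not_lt.1 hk)
    rw [add_comm, iterate_verschiebung_coeff]
    rcases m with _ | m
    · rw [zero_add, coeff_p_pow p L i, one_coeff_zero]
    · rw [coeff_p_pow_eq_zero p L (by omega), one_coeff_eq_of_pos _ _ _ (by omega)]

theorem pow_pow_apply_coeff {K : Type*} [Field K] [Algebra K L] {σ : L ≃ₐ[K] L} {x : WittVector p L}
    (h : ∀ i < n, σ (x.coeff i) = (x + 1).coeff i) (j : ℕ) {i : ℕ} (hi : i < n) :
    (σ ^ p ^ j) (x.coeff i) = (x + verschiebung^[j] 1).coeff i := by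
  rw [pow_apply_coeff h _ i hi, natCast_pow_eq_iterate_verschiebung]

/-- The coefficients of a Witt vector translated by `1` under `σ` generate the levels of the tower:
`σ ^ p ^ i` translates the Witt vector by `V ^ i 1`. -/
theorem isArtinSchreierTower {K : Type*} [Field K] [Algebra K L] {σ : L ≃ₐ[K] L}
    {x : WittVector p L} (h : ∀ i < n, σ (x.coeff i) = (x + 1).coeff i) :
    IsArtinSchreierTower p n σ x.coeff := by
  have happ : ∀ i < n, (σ ^ p ^ i) (x.coeff i) = x.coeff i + 1 := by
    intro i hi
    rw [pow_pow_apply_coeff h i hi, add_iterate_verschiebung_coeff_self, one_coeff_zero]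
  refine ⟨fun i hi ↦ ?_, fun i hi ↦ ?_, happ⟩
  · rw [mem_levelField, pow_pow_apply_coeff h _ hi,
      add_iterate_verschiebung_coeff_of_lt _ _ i.lt_succ_self]
  · rw [mem_levelField, map_sub, map_pow, happ i hi, add_pow_char]
    ring

end WittVector

theorem mainTheorem6 (p : ℕ) [Fact p.Prime] (n : ℕ) [NeZero n]
    -- a local field `K` of characteristic `p`
    (K : Type*) [Field K] [ValuativeRel K] [TopologicalSpace K] [IsNonarchimedeanLocalField K]
    [CharP K p]
    -- a finite Galois extension `L` of `K`, with its structure of a local field over `K`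
    (L : Type*) [Field L] [ValuativeRel L] [TopologicalSpace L] [IsNonarchimedeanLocalField L]
    [Algebra K L] [ValuativeExtension K L] [FiniteDimensional K L] [IsGalois K L]
    -- `L/K` is totally ramified of degree `p ^ n`
    (hdeg : Module.finrank K L = p ^ n)
    (hram : LocalRamification.IsTotallyRamified K L)
    -- a reduced Witt vector `β` over `K` and a solution `x` of `φ(x) = x ⊕ β` generating `L`
    (β : TruncatedWittVector p n K)
    (hred : ∀ i, 0 ≤ LocalRamification.ord K (β.coeff i) ∨
      ∃ m : ℤ, LocalRamification.ord K (β.coeff i) = (m : WithTop ℤ) ∧ ¬ (p : ℤ) ∣ m)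
    (x : TruncatedWittVector p n L)
    (hx : TruncatedWittVector.mapCoeff p (fun y : L => y ^ p) x =
      x + TruncatedWittVector.mapCoeff p (algebraMap K L) β)
    (hgen : IntermediateField.adjoin K (Set.range fun i => x.coeff i) = ⊤)
    -- `β_i = β_0 ω_i ^ (p ^ (n - 1)) + δ_i` with `v_K(δ_i) > v_K(β_i)`, for `1 ≤ i ≤ n - 1`
    (ω δ : Fin n → K)
    (h_decomp : ∀ i : Fin n, i ≠ 0 →
      β.coeff i = β.coeff 0 * ω i ^ p ^ (n - 1) + δ i ∧
        LocalRamification.ord K (β.coeff i) < LocalRamification.ord K (δ i))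
    -- `b_{i+1} > p ^ n u_i` for `1 ≤ i ≤ n - 1`
    (h_break : ∀ i : ℕ, 1 ≤ i → i ≤ n - 1 →
      (p : ℚ) ^ n * LocalRamification.upperBreak K L p n i <
        LocalRamification.lowerBreak K L p n (i + 1))
    -- `b_{i+1} > - p ^ (n - 1) v_K(δ_i)` for `1 ≤ i ≤ n - 1`
    (h_error : ∀ i : Fin n, i ≠ 0 →
      ∀ m : ℤ, LocalRamification.ord K (δ i) = (m : WithTop ℤ) →
        -((p : ℤ) ^ (n - 1) * m) < LocalRamification.lowerBreak K L p n ((i : ℕ) + 1))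
    -- a generator `σ` of the Galois group with `σ(x) = x ⊕ 1`
    (σ : L ≃ₐ[K] L) (hσ : ∀ τ : L ≃ₐ[K] L, τ ∈ Subgroup.zpowers σ)
    (hσx : TruncatedWittVector.mapCoeff p (fun y : L => σ y) x = x + 1) :
    (∀ i : Fin n, (σ ^ p ^ (i : ℕ)) (x.coeff i) - x.coeff i = 1) ∧
    (∀ i j : Fin n, i < j →
      LocalRamification.ordBase K L ((σ ^ p ^ (i : ℕ)) (x.coeff j) - x.coeff j) =
        ((-(1 - (p : ℚ)⁻¹) * ∑ h ∈ Finset.Icc ((i : ℕ) + 1) (j : ℕ),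
          LocalRamification.upperBreak K L p n h : ℚ) : WithTop ℚ)) := by
  have hp := Fact.out (p := p.Prime)
  have : CharP L p := charP_of_injective_algebraMap (algebraMap K L).injective p
  have hv := hram.isWildTower hdeg hσ
  have hord : orderOf σ = p ^ n := by
    rw [orderOf_eq_card_of_forall_mem_zpowers hσ, IsGalois.card_aut_eq_finrank, hdeg]
  obtain ⟨t, ht⟩ := LocalRamification.exists_ordVal_eq_one L
  set X : WittVector p L := x.out with hX
  set B : WittVector p L := WittVector.map (algebraMap K L) β.out with hB
  have hXx : ∀ i : Fin n, X.coeff i = x.coeff i := fun i ↦ x.coeff_out i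
  have hBβ : ∀ i : Fin n, B.coeff i = algebraMap K L (β.coeff i) := fun i ↦ by
    rw [hB, WittVector.map_coeff, TruncatedWittVector.coeff_out]
  have hσX : ∀ i < n, σ (X.coeff i) = (X + 1).coeff i := by
    intro i hi
    have h1 : WittVector.truncate n (X + 1) = x + 1 := by
      rw [map_add, map_one]
      exact congrArg (· + 1) x.truncateFun_out
    have h2 := congrArg (TruncatedWittVector.coeff ⟨i, hi⟩) (hσx.trans h1.symm)
    rw [WittVector.coeff_truncate] at h2
    rw [← h2, hXx ⟨i, hi⟩, TruncatedWittVector.mapCoeff, TruncatedWittVector.coeff_mk]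
  have hXB : ∀ i < n, X.coeff i ^ p = (X + B).coeff i := by
    intro i hi
    have h1 : WittVector.truncate n (X + B) =
        x + TruncatedWittVector.mapCoeff p (algebraMap K L) β := by
      rw [map_add]
      refine congrArg₂ (· + ·) x.truncateFun_out ?_
      ext j
      rw [WittVector.coeff_truncate, hBβ, TruncatedWittVector.mapCoeff,
        TruncatedWittVector.coeff_mk]
    have h2 := congrArg (TruncatedWittVector.coeff ⟨i, hi⟩) (hx.trans h1.symm)
    rw [WittVector.coeff_truncate] at h2
    rw [← h2, hXx ⟨i, hi⟩, TruncatedWittVector.mapCoeff, TruncatedWittVector.coeff_mk]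
  have hAS : IsArtinSchreierTower p n σ X.coeff :=
    WittVector.isArtinSchreierTower hσX
  obtain ⟨b, γ, hb⟩ := hAS.exists_breaks hp hv
  have hlow : ∀ i < n, (LocalRamification.lowerBreak K L p n (i + 1) : ℤ) = b i :=
    fun i hi ↦ LocalRamification.lowerBreak_eq hσ hord hv hb hi
  have hup : ∀ i < n, (p : ℚ) ^ i * LocalRamification.upperBreak K L p n (i + 1) =
      ((breakDefect p b i + b i : ℤ) : ℚ) :=
    fun i hi ↦ LocalRamification.upperBreak_eq hσ hord hv hb hi
  obtain ⟨m, hm⟩ := hb.exists_pole_orders hp hv hAS (β := B.coeff)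
    (c := fun i ↦ (WittVector.init i X + WittVector.init i B).coeff i)
    (fun i hi ↦ by rw [hXB i hi, WittVector.add_coeff_eq_init]; ring)
    (fun i _ ↦ by
      rw [levelField_zero hσ, hB, WittVector.map_coeff]
      exact Set.mem_range_self _)
    (fun i hi ↦ by
      rw [hBβ ⟨i, hi⟩]
      rcases hred ⟨i, hi⟩ with h0 | ⟨k, hk, hpk⟩
      · left
        by_cases hβ0 : β.coeff ⟨i, hi⟩ = 0
        · simp [hβ0]
        obtain ⟨k, hk⟩ := (LocalRamification.ordVal K).exists_eq_coe hβ0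
        rw [hram.ordVal_algebraMap hdeg hk]
        rw [← LocalRamification.ordVal_apply, hk] at h0
        have hk0 : 0 ≤ k := by exact_mod_cast h0
        have : 0 ≤ (p : ℤ) ^ n * k := by positivity
        exact_mod_cast this
      · exact Or.inr ⟨-k, by rw [neg_neg, hram.ordVal_algebraMap hdeg hk], by rwa [dvd_neg]⟩)
    (fun i hi w hw hk ↦ by
      refine WittVector.le_add_coeff ht (fun k ↦ ?_) (fun k ↦ ?_) i
      · rw [WittVector.coeff_init]
        split_ifs with hki
        · exact (hk k hki).1
        · simp
      · rw [WittVector.coeff_init]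
        split_ifs with hki
        · exact (hk k hki).2
        · simp)
    (fun i hi ↦ by
      have h1 := h_break (i + 1) (by omega) (by omega)
      have h2 : (0 : ℚ) < p ^ i := by
        have := hp.pos
        positivity
      have h3 := mul_lt_mul_of_pos_left h1 h2
      rw [mul_left_comm, hup i (by omega),
        show ((LocalRamification.lowerBreak K L p n (i + 1 + 1) : ℕ) : ℚ) = ((b (i + 1) : ℤ) : ℚ) by
          rw [← hlow (i + 1) hi, Int.cast_natCast]] at h3
      exact_mod_cast h3)
  have hu : ∀ i < n, LocalRamification.upperBreak K L p n (i + 1) = m i := by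
    intro i hi
    have h1 := hup i hi
    rw [(hm i hi).2.2.1] at h1
    push_cast at h1
    exact mul_left_cancel₀ (pow_ne_zero i (by exact_mod_cast hp.ne_zero)) h1
  refine ⟨fun i ↦ ?_, fun i j hij ↦ ?_⟩
  · rw [← hXx, hAS.apply_eq i i.2, add_sub_cancel_left]
  obtain ⟨i, hi⟩ := i
  obtain ⟨j, hj⟩ := j
  obtain ⟨N, rfl⟩ := Nat.exists_eq_add_of_lt (show i < j from hij)
  -- `σ ^ p ^ i` adds `1` to the shifted Witt vector `(X i, X (i + 1), …)`
  have hΔ : (σ ^ p ^ i) (x.coeff ⟨i + N + 1, hj⟩) - x.coeff ⟨i + N + 1, hj⟩ =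
      (X.shift i + 1).coeff (N + 1) - (X.shift i).coeff (N + 1) := by
    rw [← hXx, WittVector.pow_pow_apply_coeff hσX i hj, WittVector.shift_coeff,
      ← WittVector.add_iterate_verschiebung_coeff, show N + 1 + i = i + N + 1 by omega,
      ← add_assoc]
  have hval := WittVector.add_one_coeff_sub_eq_coe ht (y := X.shift i)
    (c := fun k ↦ p ^ (n - 1 - k) * m (i + k)) (N := N + 1) (fun k hk ↦ by
      rw [WittVector.shift_coeff, (hm (i + k) (by omega)).2.1, ← mul_assoc, ← pow_add,
        Nat.add_sub_cancel' (by omega)])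
    (fun k hk ↦ mul_pos (pow_pos (by exact_mod_cast hp.pos) _) (hm (i + k) (by omega)).1)
    (fun k hk ↦ by
      have h1 := (hm (i + k) (by omega)).2.2.2 (by omega)
      have h2 : (p : ℤ) ^ 2 ≤ p ^ (n - (i + k + 1)) :=
        pow_le_pow_right₀ (by exact_mod_cast hp.pos) (by omega)
      -- a factor `p` of the growth is lost to the weights `p ^ k`; the level `i + k + 1 < n - 1`
      -- leaves a factor of at least `p ^ 2`
      have h3 := (mul_le_mul_of_nonneg_right h2 (hm (i + k) (by omega)).1.le).trans_lt h1
      have h4 : n - 1 - k = n - 1 - (k + 1) + 1 := by omega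
      have h5 : (0 : ℤ) < p ^ (n - 1 - (k + 1)) := pow_pos (by exact_mod_cast hp.pos) _
      have h6 := mul_lt_mul_of_pos_left h3 h5
      rw [h4, pow_succ]
      rw [← add_assoc]
      linarith) (N + 1) le_rfl
  have hsum : ∑ k ∈ Finset.range (N + 1), (p : ℤ) ^ k * (p ^ (n - 1 - k) * m (i + k)) =
      p ^ (n - 1) * ∑ k ∈ Finset.range (N + 1), m (i + k) := by
    rw [Finset.mul_sum]
    refine Finset.sum_congr rfl fun k hk ↦ ?_
    rw [← mul_assoc, ← pow_add, Nat.add_sub_cancel' (by have := Finset.mem_range.1 hk; omega)]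
  rw [hsum] at hval
  have hram' : LocalRamification.ramIndex K L = p ^ n := by
    rw [← hdeg]
    exact hram
  rw [LocalRamification.ordBase, hΔ, ← LocalRamification.ordVal_apply, hval, WithTop.map_coe, hram',
    WithTop.coe_inj]
  have hIcc : ∑ h ∈ Finset.Icc (i + 1) (i + N + 1), LocalRamification.upperBreak K L p n h =
      ((∑ k ∈ Finset.range (N + 1), m (i + k) : ℤ) : ℚ) := by
    have h1 : Finset.Icc (i + 1) (i + N + 1) = Finset.Ico (i + 1) (i + 1 + (N + 1)) := by
      ext k
      simp only [Finset.mem_Icc, Finset.mem_Ico]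
      omega
    rw [h1, Finset.sum_Ico_eq_sum_range, Nat.add_sub_cancel_left, Int.cast_sum]
    refine Finset.sum_congr rfl fun k hk ↦ ?_
    rw [add_right_comm, hu (i + k) (by have := Finset.mem_range.1 hk; omega)]
  rw [hIcc]
  have hp0 : (p : ℚ) ≠ 0 := by exact_mod_cast hp.ne_zero
  have hn : (p : ℚ) ^ n = p ^ (n - 1) * p := by
    rw [← pow_succ, Nat.sub_add_cancel (Nat.one_le_iff_ne_zero.2 (NeZero.ne n))]
  have hpn : (p : ℚ) ^ (n - 1) ≠ 0 := pow_ne_zero _ hp0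
  push_cast
  rw [hn]
  field_simp
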